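/- Let $\mathbb{R}^2_+=\{x+iy\in\mathbb{C}:x\in\mathbb{R},\ y>0\}$ and let $dV$ be Lebesgue measure on it. For $1<p,q<\infty$ and $\nu>-1$ let $L^{p,q}_\nu(\mathbb{R}^2_+)$ be the space of measurable functions $f:\mathbb{R}^2_+\to\mathbb{C}$ (modulo equality almost everywhere) with $$\|f\|_{p,q,\nu}=\left[\int_0^\infty\left(\int_{\mathbb{R}}|f(x+iy)|^p\,dx\right)^{q/p}y^\nu\,dy\right]^{1/q}<\infty,$$ and let $A^{p,q}_\nu(\mathbb{R}^2_+)$ be its subspace of holomorphic functions. For $\beta>-1$ the weighted Bergman projection $P_\beta$ is given by $$P_\beta f(z)=c_\beta\int_{\mathbb{R}^2_+}\frac{f(w)}{(z-\bar w)^{2+\beta}}\,(\operatorname{Im}w)^\beta\,dV(w),\qquad c_\beta=\frac{2^\beta(\beta+1)}{\pi}\,e^{i\pi(2+\beta)/2},$$ with the principal branch of the power. Let $a,b,\beta>-1$, $1<p<\infty$ and $1<q\le r<\infty$. Then $P_\beta$ is bounded from $L^{p,q}_a(\mathbb{R}^2_+)$ into $A^{p,r}_b(\mathbb{R}^2_+)$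 if and only if $$a+1<q(\beta+1)\qquad\text{and}\qquad\frac{a+1}{q}=\frac{b+1}{r}.$$ This holds for each of the following two meanings of boundedness: 1. For every $f\in L^{p,q}_a(\mathbb{R}^2_+)$ the integral defining $P_\beta f(z)$ converges absolutely at every $z\in\mathbb{R}^2_+$, $P_\beta f\in A^{p,r}_b(\mathbb{R}^2_+)$, and $\|P_\beta f\|_{p,r,b}\le C\|f\|_{p,q,a}$ with a constant $C$ independent of $f$. 2. For every $f\in C_c^\infty(\mathbb{R}^2_+)$, $P_\beta f\in A^{p,r}_b(\mathbb{R}^2_+)$ and $\|P_\beta f\|_{p,r,b}\le C\|f\|_{p,q,a}$ with a constant $C$ independent of $f$. -/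

import Mathlib

open MeasureTheory
open scoped ENNReal NNReal

namespace MixedBergman

/-- The upper half-plane, as an open subset of the complex plane. -/
def upper : Set ℂ := {z : ℂ | 0 < z.im}

/-- The mixed norm
`(∫_0^∞ (∫_ℝ |f(x+iy)|^p dx)^(q/p) y^ν dy)^(1/q)`, with values in `[0, ∞]`.
Only the values of `f` on the upper half-plane matter. -/
noncomputable def mixedNorm (p q ν : ℝ) (f : ℂ → ℂ) : ℝ≥0∞ :=
  (∫⁻ y in Set.Ioi (0 : ℝ),
    (∫⁻ x : ℝ, ‖f (⟨x, y⟩ : ℂ)‖ₑ ^ p) ^ (q / p) * ENNReal.ofReal (y ^ ν)) ^ (1 / q)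

/-- Membership in the mixed norm Lebesgue space of the upper half-plane. -/
def MemL (p q ν : ℝ) (f : ℂ → ℂ) : Prop :=
  AEStronglyMeasurable f (volume.restrict upper) ∧ mixedNorm p q ν f < ⊤

/-- Membership in the mixed norm Bergman space: the holomorphic members of the mixed norm
Lebesgue space. -/
def MemA (p q ν : ℝ) (F : ℂ → ℂ) : Prop :=
  DifferentiableOn ℂ F upper ∧ MemL p q ν F

/-- The integrand `f(w) (z - w̄)^(-(2+ν)) (Im w)^ν` of the Bergman projection. For `z`, `w` in
the upper half-plane `z - w̄` lies there too, and the power is the principal one. -/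
noncomputable def integrand (ν : ℝ) (f : ℂ → ℂ) (z w : ℂ) : ℂ :=
  f w / (z - (starRingEnd ℂ) w) ^ ((2 + ν : ℝ) : ℂ) * ((w.im ^ ν : ℝ) : ℂ)

/-- The constant `2^ν (ν+1) e^{iπ(2+ν)/2} / π`, for which the kernel is positive on the
diagonal and reproduces the holomorphic functions that are square integrable
for `(Im w)^ν dV(w)`. -/
noncomputable def const (ν : ℝ) : ℂ :=
  ((2 ^ ν * (ν + 1) / Real.pi : ℝ) : ℂ) *
    Complex.exp (Complex.I * ((Real.pi * (2 + ν) / 2 : ℝ) : ℂ))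

/-- The weighted Bergman projection of the upper half-plane, given by its integral formula. -/
noncomputable def proj (ν : ℝ) (f : ℂ → ℂ) (z : ℂ) : ℂ :=
  const ν * ∫ w in upper, integrand ν f z w

/-- Smooth functions with compact support in the open upper half-plane. -/
def IsTest (f : ℂ → ℂ) : Prop :=
  ContDiff ℝ (⊤ : ℕ∞) f ∧ HasCompactSupport f ∧ tsupport f ⊆ upper

/-- The Bergman projection, densely defined on test functions, is bounded from the
`(p, q, a)` Lebesgue space into the `(p, r, b)` Bergman space. -/
def BoundedOnTest (β p q r a b : ℝ) : Prop :=
  ∃ C : ℝ≥0, ∀ f : ℂ → ℂ, IsTest f →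
    MemA p r b (proj β f) ∧ mixedNorm p r b (proj β f) ≤ C * mixedNorm p q a f

/-- The integral of the Bergman projection converges absolutely for every function of the
`(p, q, a)` Lebesgue space at every point, and defines a bounded operator from that space into
the `(p, r, b)` Bergman space. -/
def BoundedOnSpace (β p q r a b : ℝ) : Prop :=
  ∃ C : ℝ≥0, ∀ f : ℂ → ℂ, MemL p q a f →
    (∀ z ∈ upper, IntegrableOn (integrand β f z) upper) ∧
    MemA p r b (proj β f) ∧ mixedNorm p r b (proj β f) ≤ C * mixedNorm p q a f

end MixedBergman

/-!
The kernel of `P_β` acts on each horizontal line by convolution, and the `L^1` norm of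
`x ↦ |x + i s| ^ (-(2 + β))` is a constant times `s ^ (-(1 + β))`. Minkowski's integral inequality
(`lintegral_rpow_lintegral_le`) therefore bounds the `L^p` norm of `P_β f` on the line at height `y`
by a constant times `∫ v ^ β (y + v) ^ (-(1 + β)) N(v) dv`, where `N(v)` is the `L^p` norm of `f` on
the line at height `v` (`lintegral_absProj_rpow_le`). Write `γ = (a + 1) / q`.

*Sufficiency.* The one-dimensional operator `hardyOp` is an average of dilations, so Minkowski's
inequality bounds it on `L^q(y ^ a dy)` with constant
`∫ l ^ (β - γ) (1 + l) ^ (-(1 + β)) dl`, finite because `0 < γ < β + 1`. Its values are antitone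
functions, and an antitone function `H` in `L^q(y ^ a dy)` satisfies `H(y) = O(y ^ (-γ))`; splitting
`H ^ r = H ^ (r - q) H ^ q` gives the bound in `L^r(y ^ b dy)` as soon as `γ = (b + 1) / r`
(`halfNorm_le_of_antitoneOn`). Finiteness of the dominating integral at one point propagates to all
points because `|z - w̄|` and `|z₀ - w̄|` are comparable uniformly in `w`, and dominated convergence
makes `P_β f` holomorphic (`differentiableOn_proj`).

*Necessity.* The test functions are smooth cut-offs of `(Im w) ^ (-(β + 1))` to boxes
`[-t, t] × [δ, t]`. Seen from a point whose height is a large multiple of `t`, the kernel has an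
almost constant phase on the box, so there is no cancellation and
`|P_β f| ≥ c t ^ (-(1 + β)) log (t / δ)` (`exists_norm_proj_ge`, `mul_log_le_integral`).
Boundedness becomes an inequality in `t` and `δ` (`BoundedOnTest.exists_mul_log_le`). Taking
`δ = t / 2` and varying `t` forces `(a + 1) / q = (b + 1) / r`; fixing `t` and letting `δ → 0` forces
`a + 1 < q (β + 1)`, as otherwise the norms of the functions grow only like
`log (1 / δ) ^ (1 / q)`.
-/

namespace MixedBergman

/-! ### Dilations and Minkowski's integral inequality -/

theorem lintegral_comp_mul_left_pos {s : ℝ} (hs : 0 < s) (g : ℝ → ℝ≥0∞) :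
    ∫⁻ x, g (s * x) = ENNReal.ofReal s⁻¹ * ∫⁻ x, g x := by
  have h := (Homeomorph.mulLeft₀ s hs.ne').measurableEmbedding.lintegral_map
    (μ := (volume : Measure ℝ)) g
  simp only [Homeomorph.coe_mulLeft₀] at h
  rw [← h, Real.map_volume_mul_left hs.ne', lintegral_smul_measure, abs_of_pos (inv_pos.2 hs),
    smul_eq_mul]

theorem setLIntegral_Ioi_comp_mul_left_pos {s : ℝ} (hs : 0 < s) (g : ℝ → ℝ≥0∞) :
    ∫⁻ x in Set.Ioi (0 : ℝ), g (s * x) = ENNReal.ofReal s⁻¹ * ∫⁻ x in Set.Ioi (0 : ℝ), g x := by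
  rw [← lintegral_indicator measurableSet_Ioi, ← lintegral_indicator measurableSet_Ioi,
    ← lintegral_comp_mul_left_pos hs]
  congr with x
  simp [Set.indicator, hs]

/-- **Minkowski's integral inequality.** With `N v` the `L^p` norm of `h · v` and `M = ∫ N`, Hölder's
inequality with weight `N` gives `(∫ h x v dv) ^ p ≤ M ^ (p - 1) ∫ h x v ^ p N v ^ (1 - p) dv`, and
Tonelli's theorem concludes. -/
theorem lintegral_rpow_lintegral_le {α γ : Type*} [MeasurableSpace α] [MeasurableSpace γ]
    {μ : Measure α} {ν : Measure γ} [SFinite μ] [SFinite ν] {p : ℝ} (hp : 1 < p)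
    {h : α → γ → ℝ≥0∞} (hh : Measurable (Function.uncurry h)) :
    (∫⁻ x, (∫⁻ v, h x v ∂ν) ^ p ∂μ) ^ (1 / p) ≤ ∫⁻ v, (∫⁻ x, h x v ^ p ∂μ) ^ (1 / p) ∂ν := by
  have hp0 : 0 < p := by linarith
  set N : γ → ℝ≥0∞ := fun v => (∫⁻ x, h x v ^ p ∂μ) ^ (1 / p) with hN
  have hNm : Measurable N := by
    have : Measurable fun z : γ × α => h z.2 z.1 ^ p :=
      (hh.comp measurable_swap).pow_const p
    exact (this.lintegral_prod_right').pow_const _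
  set M := ∫⁻ v, N v ∂ν with hM
  by_cases hMtop : M = ⊤
  · rw [hMtop]; exact le_top
  have hNtop : ∀ᵐ v ∂ν, N v ≠ ⊤ := by
    filter_upwards [ae_lt_top hNm hMtop] with v hv using hv.ne
  set q := p.conjExponent with hq
  have hpq : p.HolderConjugate q := Real.HolderConjugate.conjExponent hp
  have hqp : q.HolderConjugate p := hpq.symm
  have hq0 : 0 < q := hqp.pos
  have hpdq : p * (1 / q) = p - 1 := by
    rw [one_div, ← hpq.one_sub_inv]; field_simp
  -- In `[0, ∞]` this is an equality if `0 < N v < ∞`; if `N v = 0`, both sides vanish for almost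
  -- every `x`.
  have hle : ∀ᵐ v ∂ν, ∀ᵐ x ∂μ, h x v ≤ N v ^ (1 / q) * (h x v * (N v ^ (1 / q))⁻¹) := by
    filter_upwards [hNtop] with v hv
    by_cases h0 : N v = 0
    · have h1 : ∫⁻ x, h x v ^ p ∂μ = 0 := by
        simpa [hN, hp0, hp0.not_gt, ENNReal.rpow_eq_zero_iff] using h0
      have hvm : Measurable fun x => h x v ^ p :=
        (hh.comp (measurable_id.prodMk measurable_const)).pow_const p
      rw [lintegral_eq_zero_iff hvm] at h1
      filter_upwards [h1] with x hx
      have : h x v = 0 := by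
        simpa [hp0, hp0.not_gt, ENNReal.rpow_eq_zero_iff] using hx
      simp [this]
    · refine Filter.Eventually.of_forall fun x => ?_
      have a1 : N v ^ (1 / q) ≠ 0 := by
        simp [ENNReal.rpow_eq_zero_iff, h0, hv]
      have a2 : N v ^ (1 / q) ≠ ⊤ := by
        simp [ENNReal.rpow_eq_top_iff, h0, hv]
      rw [mul_left_comm, ENNReal.mul_inv_cancel a1 a2, mul_one]
  have hset : MeasurableSet {z : γ × α | h z.2 z.1 ≤
      N z.1 ^ (1 / q) * (h z.2 z.1 * (N z.1 ^ (1 / q))⁻¹)} := by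
    have h1 : Measurable fun z : γ × α => h z.2 z.1 := hh.comp measurable_swap
    have h2 : Measurable fun z : γ × α => N z.1 ^ (1 / q) :=
      (hNm.comp measurable_fst).pow_const _
    exact measurableSet_le h1 (h2.mul (h1.mul h2.inv))
  have hle' := (Measure.ae_ae_comm hset).1 hle
  have key : ∀ᵐ x ∂μ, (∫⁻ v, h x v ∂ν) ^ p ≤
      M ^ (p - 1) * ∫⁻ v, (h x v * (N v ^ (1 / q))⁻¹) ^ p ∂ν := by
    filter_upwards [hle'] with x hx
    have hxm : Measurable fun v => h x v := hh.comp (measurable_const.prodMk measurable_id)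
    have h1 := ENNReal.lintegral_mul_le_Lp_mul_Lq ν hqp (f := fun v => N v ^ (1 / q))
      (g := fun v => h x v * (N v ^ (1 / q))⁻¹) (hNm.pow_const _).aemeasurable
      (hxm.mul (hNm.pow_const _).inv).aemeasurable
    have h2 := (lintegral_mono_ae hx).trans h1
    have h3 : ∀ v, (N v ^ (1 / q)) ^ q = N v := fun v => by
      rw [← ENNReal.rpow_mul, one_div_mul_cancel hq0.ne', ENNReal.rpow_one]
    simp only [h3] at h2
    refine (ENNReal.rpow_le_rpow h2 hp0.le).trans ?_
    rw [ENNReal.mul_rpow_of_nonneg _ _ hp0.le, ← ENNReal.rpow_mul, ← ENNReal.rpow_mul,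
      one_div_mul_cancel hp0.ne', ENNReal.rpow_one, mul_comm (1 / q), hpdq]
  have hcol : ∀ v, ∫⁻ x, (h x v * (N v ^ (1 / q))⁻¹) ^ p ∂μ ≤ N v := by
    intro v
    have hvm : Measurable fun x => h x v ^ p :=
      (hh.comp (measurable_id.prodMk measurable_const)).pow_const p
    have e : ∫⁻ x, h x v ^ p ∂μ = N v ^ p := by
      simp only [hN]
      rw [← ENNReal.rpow_mul, one_div_mul_cancel hp0.ne', ENNReal.rpow_one]
    simp_rw [ENNReal.mul_rpow_of_nonneg _ _ hp0.le]
    rw [lintegral_mul_const _ hvm, e, ENNReal.inv_rpow, ← ENNReal.rpow_mul (N v) (1 / q),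
      mul_comm (1 / q), hpdq]
    rcases eq_or_ne (N v) 0 with h0 | h0
    · simp [h0, hp0]
    rcases eq_or_ne (N v) ⊤ with h1 | h1
    · simp [h1]
    rw [← ENNReal.rpow_neg, ← ENNReal.rpow_add _ _ h0 h1]
    simp
  have fin : ∫⁻ x, (∫⁻ v, h x v ∂ν) ^ p ∂μ ≤ M ^ p := by
    calc ∫⁻ x, (∫⁻ v, h x v ∂ν) ^ p ∂μ
        ≤ ∫⁻ x, M ^ (p - 1) * ∫⁻ v, (h x v * (N v ^ (1 / q))⁻¹) ^ p ∂ν ∂μ :=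
          lintegral_mono_ae key
      _ = M ^ (p - 1) * ∫⁻ x, ∫⁻ v, (h x v * (N v ^ (1 / q))⁻¹) ^ p ∂ν ∂μ := by
          refine lintegral_const_mul' _ _ ?_
          exact ENNReal.rpow_ne_top_of_nonneg (by linarith) hMtop
      _ = M ^ (p - 1) * ∫⁻ v, ∫⁻ x, (h x v * (N v ^ (1 / q))⁻¹) ^ p ∂μ ∂ν := by
          rw [lintegral_lintegral_swap]
          have h2 : Measurable fun z : α × γ => N z.2 ^ (1 / q) :=
            (hNm.comp measurable_snd).pow_const _
          exact ((hh.mul h2.inv).pow_const p).aemeasurable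
      _ ≤ M ^ (p - 1) * M := by gcongr; exact lintegral_mono hcol
      _ = M ^ p := by
          nth_rewrite 2 [← ENNReal.rpow_one M]
          rw [← ENNReal.rpow_add_of_nonneg _ _ (by linarith) zero_le_one]
          simp
  calc _ ≤ (M ^ p) ^ (1 / p) := by gcongr
    _ = M := by rw [← ENNReal.rpow_mul, mul_one_div_cancel hp0.ne', ENNReal.rpow_one]

/-! ### A Hardy-type operator on the half-line -/

/-- The Hardy-type operator on `(0, ∞)` with kernel `v ^ β / (y + v) ^ (1 + β)`. It dominates the
Bergman projection once the `L^p` norm in the horizontal variable has been taken. -/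
noncomputable def hardyOp (β : ℝ) (G : ℝ → ℝ≥0∞) (y : ℝ) : ℝ≥0∞ :=
  ∫⁻ v in Set.Ioi (0 : ℝ), G v * ENNReal.ofReal (v ^ β * (y + v) ^ (-(1 + β)))

theorem hardyOp_eq_dilation (β : ℝ) (G : ℝ → ℝ≥0∞) {y : ℝ} (hy : 0 < y) :
    hardyOp β G y = ∫⁻ l in Set.Ioi (0 : ℝ),
      G (y * l) * ENNReal.ofReal (l ^ β * (1 + l) ^ (-(1 + β))) := by
  have h := setLIntegral_Ioi_comp_mul_left_pos hy
    (fun v => G v * ENNReal.ofReal (v ^ β * (y + v) ^ (-(1 + β))))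
  have h2 : hardyOp β G y = ENNReal.ofReal y * ∫⁻ l in Set.Ioi (0 : ℝ),
      G (y * l) * ENNReal.ofReal ((y * l) ^ β * (y + y * l) ^ (-(1 + β))) := by
    rw [h, ← mul_assoc, ← ENNReal.ofReal_mul hy.le, mul_inv_cancel₀ hy.ne', ENNReal.ofReal_one,
      one_mul, hardyOp]
  rw [h2, ← lintegral_const_mul' _ _ ENNReal.ofReal_ne_top]
  refine setLIntegral_congr_fun measurableSet_Ioi fun l hl => ?_
  have hl : 0 < l := hl
  rw [mul_left_comm, ← ENNReal.ofReal_mul hy.le]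
  congr 2
  rw [show y + y * l = y * (1 + l) by ring, Real.mul_rpow hy.le hl.le,
    Real.mul_rpow hy.le (by positivity)]
  have : y * (y ^ β * y ^ (-(1 + β))) = 1 := by
    rw [← Real.rpow_add hy]
    nth_rewrite 1 [← Real.rpow_one y]
    rw [← Real.rpow_add hy]
    ring_nf
    simp
  linear_combination (l ^ β * (1 + l) ^ (-(1 + β))) * this

theorem hardyOp_antitoneOn {β : ℝ} (hβ : -1 < β) (G : ℝ → ℝ≥0∞) {y y' : ℝ} (hy : 0 < y)
    (h : y ≤ y') : hardyOp β G y' ≤ hardyOp β G y := by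
  refine setLIntegral_mono' measurableSet_Ioi fun v hv => ?_
  have hv : 0 < v := hv
  refine mul_le_mul' le_rfl (ENNReal.ofReal_le_ofReal
    (mul_le_mul_of_nonneg_left ?_ (by positivity)))
  exact Real.rpow_le_rpow_of_nonpos (by positivity) (by linarith) (by linarith)

/-- The `L^q(y ^ a dy)` norm of a nonnegative function on the half-line. -/
noncomputable def halfNorm (q a : ℝ) (G : ℝ → ℝ≥0∞) : ℝ≥0∞ :=
  (∫⁻ y in Set.Ioi (0 : ℝ), G y ^ q * ENNReal.ofReal (y ^ a)) ^ (1 / q)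

theorem halfNorm_rpow {q : ℝ} (hq : 0 < q) (a : ℝ) (G : ℝ → ℝ≥0∞) :
    halfNorm q a G ^ q = ∫⁻ y in Set.Ioi (0 : ℝ), G y ^ q * ENNReal.ofReal (y ^ a) := by
  rw [halfNorm, ← ENNReal.rpow_mul, one_div_mul_cancel hq.ne', ENNReal.rpow_one]

theorem halfNorm_dilation {q a : ℝ} (hq : 0 < q) (G : ℝ → ℝ≥0∞) {l : ℝ} (hl : 0 < l) :
    halfNorm q a (fun y => G (y * l)) =
      ENNReal.ofReal (l ^ (-((a + 1) / q))) * halfNorm q a G := by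
  have h := setLIntegral_Ioi_comp_mul_left_pos hl (fun y => G y ^ q * ENNReal.ofReal (y ^ a))
  have h2 : ∫⁻ y in Set.Ioi (0 : ℝ), G (y * l) ^ q * ENNReal.ofReal (y ^ a) =
      ENNReal.ofReal (l ^ (-a)) *
        ∫⁻ y in Set.Ioi (0 : ℝ), G (l * y) ^ q * ENNReal.ofReal ((l * y) ^ a) := by
    rw [← lintegral_const_mul' _ _ ENNReal.ofReal_ne_top]
    refine setLIntegral_congr_fun measurableSet_Ioi fun y hy => ?_
    have hy : 0 < y := hy
    rw [mul_left_comm, ← ENNReal.ofReal_mul (by positivity), mul_comm y l,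
      Real.mul_rpow hl.le hy.le, ← mul_assoc, ← Real.rpow_add hl]
    simp
  rw [halfNorm, h2, h, ← mul_assoc, ← ENNReal.ofReal_mul (by positivity),
    ENNReal.mul_rpow_of_nonneg _ _ (by positivity), ENNReal.ofReal_rpow_of_pos (by positivity),
    halfNorm]
  congr 2
  rw [← Real.rpow_neg_one l, ← Real.rpow_add hl, ← Real.rpow_mul hl.le]
  congr 1
  ring

theorem lintegral_hardy_kernel_lt_top {β γ : ℝ} (hγ : 0 < γ) (hγβ : γ < β + 1) :
    ∫⁻ l in Set.Ioi (0 : ℝ), ENNReal.ofReal (l ^ (β - γ) * (1 + l) ^ (-(1 + β))) < ⊤ := by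
  rw [← Set.Ioc_union_Ioi_eq_Ioi zero_le_one]
  refine (lintegral_union_le _ _ _).trans_lt (ENNReal.add_lt_top.2 ⟨?_, ?_⟩)
  · have hi : IntegrableOn (fun l : ℝ => l ^ (β - γ)) (Set.Ioc 0 1) :=
      (intervalIntegrable_iff_integrableOn_Ioc_of_le zero_le_one).1
        (intervalIntegral.intervalIntegrable_rpow' (by linarith))
    refine (setLIntegral_mono' measurableSet_Ioc fun l hl => ?_).trans_lt hi.lintegral_lt_top
    have := hl.1
    refine ENNReal.ofReal_le_ofReal (mul_le_of_le_one_right (by positivity) ?_)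
    exact Real.rpow_le_one_of_one_le_of_nonpos (by linarith) (by linarith)
  · have hi : IntegrableOn (fun l : ℝ => l ^ (-1 - γ)) (Set.Ioi 1) :=
      integrableOn_Ioi_rpow_of_lt (by linarith) zero_lt_one
    refine (setLIntegral_mono' measurableSet_Ioi fun l hl => ?_).trans_lt hi.lintegral_lt_top
    have hl0 : 0 < l := zero_lt_one.trans hl
    refine ENNReal.ofReal_le_ofReal ?_
    rw [show -1 - γ = (β - γ) + (-(1 + β)) by ring, Real.rpow_add hl0]
    gcongr ?_ * ?_
    exact Real.rpow_le_rpow_of_nonpos hl0 (by linarith) (by linarith)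

/-- Boundedness of the Hardy-type operator on one weighted space: after a dilation it is an average
of dilates of `G`, and Minkowski's inequality applies. -/
theorem halfNorm_hardyOp_le {β q a : ℝ} (hq : 1 < q) {G : ℝ → ℝ≥0∞} (hG : Measurable G) :
    halfNorm q a (hardyOp β G) ≤
      (∫⁻ l in Set.Ioi (0 : ℝ),
        ENNReal.ofReal (l ^ (β - (a + 1) / q) * (1 + l) ^ (-(1 + β)))) * halfNorm q a G := by
  have hq0 : 0 < q := by linarith
  set k : ℝ → ℝ≥0∞ := fun l => ENNReal.ofReal (l ^ β * (1 + l) ^ (-(1 + β))) with hk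
  have hkm : Measurable k := by fun_prop
  have e1 : halfNorm q a (hardyOp β G) = (∫⁻ y in Set.Ioi (0 : ℝ),
      (∫⁻ l in Set.Ioi (0 : ℝ),
        G (y * l) * k l * ENNReal.ofReal (y ^ a) ^ (1 / q)) ^ q) ^ (1 / q) := by
    rw [halfNorm]
    congr 1
    refine setLIntegral_congr_fun measurableSet_Ioi fun y hy => ?_
    have hy : 0 < y := hy
    have hm : Measurable fun l => G (y * l) * k l :=
      (hG.comp (measurable_const_mul y)).mul hkm
    rw [lintegral_mul_const _ hm, ENNReal.mul_rpow_of_nonneg _ _ hq0.le, ← ENNReal.rpow_mul,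
      one_div_mul_cancel hq0.ne', ENNReal.rpow_one, hardyOp_eq_dilation β G hy]
  have hmeas : Measurable (Function.uncurry fun y l : ℝ =>
      G (y * l) * k l * ENNReal.ofReal (y ^ a) ^ (1 / q)) := by
    have h1 : Measurable fun z : ℝ × ℝ => G (z.1 * z.2) := hG.comp (by fun_prop)
    have h2 : Measurable fun z : ℝ × ℝ => k z.2 := hkm.comp measurable_snd
    have h3 : Measurable fun z : ℝ × ℝ => ENNReal.ofReal (z.1 ^ a) ^ (1 / q) := by fun_prop
    exact (h1.mul h2).mul h3
  rw [e1]
  refine (lintegral_rpow_lintegral_le hq hmeas).trans ?_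
  rw [← lintegral_mul_const _ (by fun_prop)]
  refine setLIntegral_mono' measurableSet_Ioi fun l hl => ?_
  have hl : 0 < l := hl
  have e2 : ∀ y, (G (y * l) * k l * ENNReal.ofReal (y ^ a) ^ (1 / q)) ^ q =
      k l ^ q * (G (y * l) ^ q * ENNReal.ofReal (y ^ a)) := fun y => by
    rw [ENNReal.mul_rpow_of_nonneg _ _ hq0.le, ENNReal.mul_rpow_of_nonneg _ _ hq0.le,
      ← ENNReal.rpow_mul, one_div_mul_cancel hq0.ne', ENNReal.rpow_one]
    ring
  simp only [e2]
  rw [lintegral_const_mul' _ _ (by simp [hk, hq0.le]),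
    ENNReal.mul_rpow_of_nonneg _ _ (by positivity), ← ENNReal.rpow_mul,
    mul_one_div_cancel hq0.ne', ENNReal.rpow_one]
  have e3 := halfNorm_dilation (a := a) hq0 G hl
  rw [halfNorm] at e3
  rw [e3, ← mul_assoc, hk, ← ENNReal.ofReal_mul (by positivity)]
  refine le_of_eq ?_
  congr 2
  rw [sub_eq_add_neg, Real.rpow_add hl]
  ring

/-- An antitone function in `L^q(y ^ a dy)` is pointwise `O(y ^ (-(a + 1) / q))`. -/
theorem rpow_mul_le_halfNorm_rpow {q a : ℝ} (hq : 0 < q) (ha : -1 < a) {H : ℝ → ℝ≥0∞}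
    (hH : ∀ ⦃y y'⦄, 0 < y → y ≤ y' → H y' ≤ H y) {y : ℝ} (hy : 0 < y) :
    H y ^ q * ENNReal.ofReal (y ^ (a + 1)) ≤ ENNReal.ofReal (a + 1) * halfNorm q a H ^ q := by
  have h1 : ∫⁻ s in Set.Ioc 0 y, ENNReal.ofReal (s ^ a) = ENNReal.ofReal (y ^ (a + 1) / (a + 1)) := by
    rw [← ofReal_integral_eq_lintegral_ofReal
      ((intervalIntegrable_iff_integrableOn_Ioc_of_le hy.le).1
        (intervalIntegral.intervalIntegrable_rpow' ha))
      ((ae_restrict_iff' measurableSet_Ioc).2 (.of_forall fun s hs =>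
        Real.rpow_nonneg hs.1.le _)), ← intervalIntegral.integral_of_le hy.le,
      integral_rpow (Or.inl ha), Real.zero_rpow (by linarith), sub_zero]
  have h2 : H y ^ q * ENNReal.ofReal (y ^ (a + 1) / (a + 1)) ≤ halfNorm q a H ^ q := by
    rw [halfNorm_rpow hq, ← h1, ← lintegral_const_mul _ (by fun_prop)]
    refine (setLIntegral_mono' measurableSet_Ioc fun s hs => ?_).trans
      (lintegral_mono_set Set.Ioc_subset_Ioi_self)
    gcongr
    exact hH hs.1 hs.2
  calc H y ^ q * ENNReal.ofReal (y ^ (a + 1))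
      = ENNReal.ofReal (a + 1) * (H y ^ q * ENNReal.ofReal (y ^ (a + 1) / (a + 1))) := by
        rw [mul_left_comm, ← ENNReal.ofReal_mul (by linarith), mul_div_cancel₀]
        linarith
    _ ≤ _ := by gcongr

/-- For antitone functions, and at equal homogeneity, the norm with the smaller exponent controls the
one with the larger exponent: `H ^ r = H ^ (r - q) H ^ q`, where the first factor is bounded
pointwise by `rpow_mul_le_halfNorm_rpow`. -/
theorem halfNorm_le_of_antitoneOn {q r a b : ℝ} (hq : 0 < q) (hqr : q ≤ r) (ha : -1 < a)
    (hab : (a + 1) / q = (b + 1) / r) {H : ℝ → ℝ≥0∞}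
    (hH : ∀ ⦃y y'⦄, 0 < y → y ≤ y' → H y' ≤ H y) :
    halfNorm r b H ≤ ENNReal.ofReal (a + 1) ^ (1 / q - 1 / r) * halfNorm q a H := by
  have hr : 0 < r := by linarith
  set N := halfNorm q a H with hN
  set c := ENNReal.ofReal (a + 1) with hc
  have hc0 : c ≠ 0 := by simp [hc]; linarith
  have hct : c ≠ ⊤ := ENNReal.ofReal_ne_top
  rcases eq_or_ne N ⊤ with hNt | hNt
  · rw [hNt, ENNReal.mul_top]
    · exact le_top
    · simp [ENNReal.rpow_eq_zero_iff, hc0, hct]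
  have hs : 0 ≤ (r - q) / q := div_nonneg (by linarith) hq.le
  have hpt : ∀ y ∈ Set.Ioi (0 : ℝ), H y ^ r * ENNReal.ofReal (y ^ b) ≤
      (c * N ^ q) ^ ((r - q) / q) * (H y ^ q * ENNReal.ofReal (y ^ a)) := by
    intro y hy
    have hy : 0 < y := hy
    have h1 := ENNReal.rpow_le_rpow (rpow_mul_le_halfNorm_rpow hq ha hH hy) hs
    rw [ENNReal.mul_rpow_of_nonneg _ _ hs, ← ENNReal.rpow_mul,
      ENNReal.ofReal_rpow_of_pos (by positivity), ← Real.rpow_mul hy.le] at h1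
    calc H y ^ r * ENNReal.ofReal (y ^ b)
        = (H y ^ (q * ((r - q) / q)) * ENNReal.ofReal (y ^ ((a + 1) * ((r - q) / q)))) *
            (H y ^ q * ENNReal.ofReal (y ^ a)) := by
          rw [mul_mul_mul_comm, ← ENNReal.rpow_add_of_nonneg _ _ (by positivity) hq.le,
            ← ENNReal.ofReal_mul (by positivity), ← Real.rpow_add hy]
          have e1 : q * ((r - q) / q) + q = r := by field_simp; ring
          have e2 : (a + 1) * ((r - q) / q) + a = b := by
            field_simp at hab ⊢
            linarith
          rw [e1, e2]
      _ ≤ _ := by gcongr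
  have h2 : halfNorm r b H ^ r ≤ (c * N ^ q) ^ ((r - q) / q) * N ^ q := by
    rw [halfNorm_rpow hr, hN, halfNorm_rpow hq]
    refine (setLIntegral_mono' measurableSet_Ioi hpt).trans ?_
    rw [lintegral_const_mul', hN, halfNorm_rpow hq]
    refine ENNReal.rpow_ne_top_of_nonneg hs (ENNReal.mul_ne_top hct ?_)
    exact ENNReal.rpow_ne_top_of_nonneg hq.le hNt
  have h3 := ENNReal.rpow_le_rpow h2 (one_div_nonneg.2 hr.le)
  rw [← ENNReal.rpow_mul, mul_one_div_cancel hr.ne', ENNReal.rpow_one] at h3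
  refine h3.trans_eq ?_
  rw [ENNReal.mul_rpow_of_nonneg _ _ hs, ENNReal.mul_rpow_of_nonneg _ _ (by positivity),
    ENNReal.mul_rpow_of_nonneg _ _ (by positivity), ← ENNReal.rpow_mul, ← ENNReal.rpow_mul,
    ← ENNReal.rpow_mul, ← ENNReal.rpow_mul, mul_assoc,
    ← ENNReal.rpow_add_of_nonneg _ _ (by positivity) (by positivity)]
  have e1 : (r - q) / q * (1 / r) = 1 / q - 1 / r := by field_simp
  have e2 : q * ((r - q) / q) * (1 / r) + q * (1 / r) = 1 := by field_simp; ring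
  rw [e1, show q * (1 / q - 1 / r) + q * (1 / r) = 1 by field_simp; ring, ENNReal.rpow_one]

/-! ### Mixed norms and the convolution structure on horizontal lines -/

theorem isOpen_upper : IsOpen upper := isOpen_lt continuous_const Complex.continuous_im

theorem measurableSet_upper : MeasurableSet upper := isOpen_upper.measurableSet

theorem measurable_complex_mk : Measurable fun z : ℝ × ℝ => (⟨z.1, z.2⟩ : ℂ) :=
  Complex.measurableEquivRealProd.symm.measurable

theorem measurePreserving_mk_upper :
    MeasurePreserving (fun z : ℝ × ℝ => (⟨z.1, z.2⟩ : ℂ))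
      ((volume : Measure ℝ).prod (volume.restrict (Set.Ioi 0))) (volume.restrict upper) := by
  have h := (Complex.volume_preserving_equiv_real_prod.symm).restrict_preimage
    measurableSet_upper
  have e : (Complex.measurableEquivRealProd.symm ⁻¹' upper) = Set.univ ×ˢ Set.Ioi (0 : ℝ) := by
    ext z
    simp [upper, Complex.measurableEquivRealProd]
  rw [e, Measure.volume_eq_prod, ← Measure.prod_restrict, Measure.restrict_univ] at h
  exact h

theorem setLIntegral_upper {g : ℂ → ℝ≥0∞} (hg : Measurable g) :
    ∫⁻ w in upper, g w = ∫⁻ v in Set.Ioi (0 : ℝ), ∫⁻ u : ℝ, g ⟨u, v⟩ := by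
  rw [← measurePreserving_mk_upper.lintegral_comp hg,
    lintegral_prod_symm' (fun z : ℝ × ℝ => g ⟨z.1, z.2⟩) (hg.comp measurable_complex_mk)]

/-- The `L^p` norm of `f` on the horizontal line at height `y`. -/
noncomputable def lineNorm (p : ℝ) (f : ℂ → ℂ) (y : ℝ) : ℝ≥0∞ :=
  (∫⁻ x : ℝ, ‖f ⟨x, y⟩‖ₑ ^ p) ^ (1 / p)

theorem mixedNorm_eq_halfNorm (p q ν : ℝ) (f : ℂ → ℂ) :
    mixedNorm p q ν f = halfNorm q ν (lineNorm p f) := by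
  simp only [mixedNorm, halfNorm, lineNorm, ← ENNReal.rpow_mul, one_div_mul_eq_div]

theorem measurable_lineNorm {p : ℝ} {f : ℂ → ℂ} (hf : Measurable f) :
    Measurable (lineNorm p f) := by
  have h : Measurable fun z : ℝ × ℝ => ‖f ⟨z.2, z.1⟩‖ₑ ^ p :=
    ((hf.comp (measurable_complex_mk.comp measurable_swap)).enorm).pow_const p
  exact h.lintegral_prod_right'.pow_const _

theorem mixedNorm_congr_ae {p q ν : ℝ} {f g : ℂ → ℂ} (h : f =ᵐ[volume.restrict upper] g) :
    mixedNorm p q ν f = mixedNorm p q ν g := by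
  have h1 := measurePreserving_mk_upper.quasiMeasurePreserving.ae h
  have h2 := Measure.ae_ae_of_ae_prod
    (Measure.measurePreserving_swap.quasiMeasurePreserving.ae h1)
  simp only [mixedNorm]
  congr 1
  refine lintegral_congr_ae ?_
  filter_upwards [h2] with y hy
  congr 2
  refine lintegral_congr_ae ?_
  filter_upwards [hy] with x hx
  simp only [Prod.swap] at hx
  rw [hx]

theorem halfNorm_mono {q a : ℝ} (hq : 0 < q) {G H : ℝ → ℝ≥0∞} (h : ∀ y, 0 < y → G y ≤ H y) :
    halfNorm q a G ≤ halfNorm q a H := by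
  refine ENNReal.rpow_le_rpow (setLIntegral_mono' measurableSet_Ioi fun y hy => ?_)
    (by positivity)
  gcongr
  exact h y hy

theorem halfNorm_const_mul {q a : ℝ} (hq : 0 < q) {c : ℝ≥0∞} (hc : c ≠ ⊤) (G : ℝ → ℝ≥0∞) :
    halfNorm q a (fun y => c * G y) = c * halfNorm q a G := by
  simp only [halfNorm, ENNReal.mul_rpow_of_nonneg _ _ hq.le, mul_assoc]
  rw [lintegral_const_mul' _ _ (by simp [hq.le, hc]), ENNReal.mul_rpow_of_nonneg _ _ (by positivity),
    ← ENNReal.rpow_mul, mul_one_div_cancel hq.ne', ENNReal.rpow_one]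

/-- The integral of the modulus of the integrand of the Bergman projection. -/
noncomputable def absProj (β : ℝ) (f : ℂ → ℂ) (z : ℂ) : ℝ≥0∞ :=
  ∫⁻ w in upper, ‖integrand β f z w‖ₑ

theorem enorm_proj_le (β : ℝ) (f : ℂ → ℂ) (z : ℂ) :
    ‖proj β f z‖ₑ ≤ ‖const β‖ₑ * absProj β f z := by
  rw [proj, enorm_mul]
  gcongr
  exact enorm_integral_le_lintegral_enorm _

theorem sub_conj_mk (x y u v : ℝ) :
    (⟨x, y⟩ : ℂ) - (starRingEnd ℂ) ⟨u, v⟩ = ⟨x - u, y + v⟩ := by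
  apply Complex.ext <;> simp

theorem norm_integrand (β : ℝ) (f : ℂ → ℂ) (z : ℂ) {w : ℂ} (hw : w ∈ upper) :
    ‖integrand β f z w‖ = ‖f w‖ * (w.im ^ β * ‖z - (starRingEnd ℂ) w‖ ^ (-(2 + β))) := by
  have hw' : 0 < w.im := hw
  rw [integrand, div_eq_mul_inv, mul_assoc, norm_mul, norm_mul, norm_inv, Complex.norm_cpow_real,
    Complex.norm_real, Real.norm_of_nonneg (by positivity), Real.rpow_neg (norm_nonneg _),
    mul_comm (w.im ^ β)]

theorem enorm_integrand (β : ℝ) (f : ℂ → ℂ) (z : ℂ) {w : ℂ} (hw : w ∈ upper) :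
    ‖integrand β f z w‖ₑ = ‖f w‖ₑ *
      ENNReal.ofReal (w.im ^ β * ‖z - (starRingEnd ℂ) w‖ ^ (-(2 + β))) := by
  rw [← ofReal_norm, norm_integrand β f z hw, ENNReal.ofReal_mul (norm_nonneg _), ofReal_norm]

theorem measurable_integrand (β : ℝ) {f : ℂ → ℂ} (hf : Measurable f) (z : ℂ) :
    Measurable (integrand β f z) := by
  unfold integrand
  have h1 : Measurable fun w : ℂ => (z - (starRingEnd ℂ) w) :=
    measurable_const.sub Complex.continuous_conj.measurable
  have h2 : Measurable fun w : ℂ => ((w.im ^ β : ℝ) : ℂ) :=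
    Complex.measurable_ofReal.comp (Complex.measurable_im.pow_const β)
  exact (hf.div (h1.pow_const _)).mul h2

/-- The `L^1` norm of the kernel `|x + i| ^ (-(2 + β))` on the line. -/
noncomputable def kernelMass (β : ℝ) : ℝ≥0∞ :=
  ∫⁻ t : ℝ, ENNReal.ofReal (‖(⟨t, 1⟩ : ℂ)‖ ^ (-(2 + β)))

theorem kernelMass_lt_top {β : ℝ} (hβ : -1 < β) : kernelMass β < ⊤ := by
  have h := integrable_rpow_neg_one_add_norm_sq (E := ℝ) (μ := volume) (r := 2 + β)
    (by simp; linarith)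
  refine lt_of_eq_of_lt (lintegral_congr fun t => ?_) h.lintegral_lt_top
  congr 1
  have : ‖(⟨t, 1⟩ : ℂ)‖ = (1 + ‖t‖ ^ 2) ^ (1 / 2 : ℝ) := by
    rw [← Real.sqrt_eq_rpow, Complex.norm_def, Complex.normSq_mk]
    congr 1
    simp
    ring
  rw [this, ← Real.rpow_mul (by positivity)]
  congr 1
  ring

theorem lintegral_kernel_line (β : ℝ) {s : ℝ} (hs : 0 < s) :
    ∫⁻ t : ℝ, ENNReal.ofReal (‖(⟨t, s⟩ : ℂ)‖ ^ (-(2 + β))) =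
      kernelMass β * ENNReal.ofReal (s ^ (-(1 + β))) := by
  have h := lintegral_comp_mul_left_pos hs
    (fun t => ENNReal.ofReal (‖(⟨t, s⟩ : ℂ)‖ ^ (-(2 + β))))
  have e : ∀ x : ℝ, ENNReal.ofReal (‖(⟨s * x, s⟩ : ℂ)‖ ^ (-(2 + β))) =
      ENNReal.ofReal (s ^ (-(2 + β))) * ENNReal.ofReal (‖(⟨x, 1⟩ : ℂ)‖ ^ (-(2 + β))) := by
    intro x
    rw [← ENNReal.ofReal_mul (by positivity), ← Real.mul_rpow hs.le (norm_nonneg _)]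
    congr 2
    rw [← Real.norm_of_nonneg hs.le, ← Complex.norm_real s, ← norm_mul]
    congr 1
    apply Complex.ext <;> simp [abs_of_pos hs]
  simp only [e] at h
  rw [lintegral_const_mul' _ _ ENNReal.ofReal_ne_top] at h
  have h3 : ∫⁻ t : ℝ, ENNReal.ofReal (‖(⟨t, s⟩ : ℂ)‖ ^ (-(2 + β))) =
      ENNReal.ofReal s * (ENNReal.ofReal s⁻¹ *
        ∫⁻ t : ℝ, ENNReal.ofReal (‖(⟨t, s⟩ : ℂ)‖ ^ (-(2 + β)))) := by
    rw [← mul_assoc, ← ENNReal.ofReal_mul hs.le, mul_inv_cancel₀ hs.ne', ENNReal.ofReal_one,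
      one_mul]
  rw [h3, ← h, ← mul_assoc, ← ENNReal.ofReal_mul hs.le, mul_comm, kernelMass]
  congr 2
  nth_rewrite 1 [← Real.rpow_one s]
  rw [← Real.rpow_add hs]
  congr 1
  ring

/-- On each horizontal line the Bergman kernel acts by convolutions, so that the inequalities of
Minkowski and Young reduce the `L^p` bound to the Hardy-type operator. -/
theorem lintegral_absProj_rpow_le {β p : ℝ} (hβ : -1 < β) (hp : 1 < p) {f : ℂ → ℂ}
    (hf : Measurable f) {y : ℝ} (hy : 0 < y) :
    (∫⁻ x : ℝ, absProj β f ⟨x, y⟩ ^ p) ^ (1 / p) ≤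
      kernelMass β * hardyOp β (lineNorm p f) y := by
  have hp0 : 0 < p := by linarith
  set k : ℝ → ℝ → ℝ≥0∞ := fun v t =>
    ENNReal.ofReal (v ^ β * ‖(⟨t, y + v⟩ : ℂ)‖ ^ (-(2 + β))) with hk
  have hkm : Measurable fun z : ℝ × ℝ => k z.1 z.2 := by
    have h1 : Measurable fun z : ℝ × ℝ => (⟨z.2, y + z.1⟩ : ℂ) :=
      measurable_complex_mk.comp (measurable_snd.prodMk (measurable_const.add measurable_fst))
    exact ((measurable_fst.pow_const β).mul (h1.norm.pow_const _)).ennreal_ofReal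
  have hmeas : Measurable (Function.uncurry fun (x : ℝ) (z : ℝ × ℝ) =>
      ‖f ⟨x - z.2, z.1⟩‖ₑ * k z.1 z.2) := by
    have h1 : Measurable fun z : ℝ × (ℝ × ℝ) => (⟨z.1 - z.2.2, z.2.1⟩ : ℂ) :=
      measurable_complex_mk.comp
        ((measurable_fst.sub (measurable_snd.comp measurable_snd)).prodMk
          (measurable_fst.comp measurable_snd))
    exact (hf.comp h1).enorm.mul (hkm.comp measurable_snd)
  have e1 : ∀ x, absProj β f ⟨x, y⟩ = ∫⁻ z : ℝ × ℝ, ‖f ⟨x - z.2, z.1⟩‖ₑ * k z.1 z.2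
      ∂((volume.restrict (Set.Ioi 0)).prod volume) := by
    intro x
    rw [lintegral_prod (fun z : ℝ × ℝ => ‖f ⟨x - z.2, z.1⟩‖ₑ * k z.1 z.2)
      (hmeas.comp measurable_prodMk_left).aemeasurable, absProj,
      setLIntegral_upper (measurable_integrand β hf _).enorm]
    refine setLIntegral_congr_fun measurableSet_Ioi fun v hv => ?_
    rw [← lintegral_sub_left_eq_self _ x]
    refine lintegral_congr fun t => ?_
    rw [enorm_integrand β f _ (show (⟨x - t, v⟩ : ℂ) ∈ upper from hv), sub_conj_mk, sub_sub_cancel]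
  simp only [e1]
  refine (lintegral_rpow_lintegral_le hp hmeas).trans_eq ?_
  have e2 : ∀ z : ℝ × ℝ, (∫⁻ x : ℝ, (‖f ⟨x - z.2, z.1⟩‖ₑ * k z.1 z.2) ^ p) ^ (1 / p) =
      lineNorm p f z.1 * k z.1 z.2 := by
    intro z
    simp only [ENNReal.mul_rpow_of_nonneg _ _ hp0.le]
    rw [lintegral_mul_const' _ _ (by simp [hk, hp0.le]),
      lintegral_sub_right_eq_self (fun x : ℝ => ‖f ⟨x, z.1⟩‖ₑ ^ p) z.2,
      ENNReal.mul_rpow_of_nonneg _ _ (by positivity), ← ENNReal.rpow_mul,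
      mul_one_div_cancel hp0.ne', ENNReal.rpow_one, lineNorm]
  simp only [e2]
  rw [lintegral_prod (fun z : ℝ × ℝ => lineNorm p f z.1 * k z.1 z.2)
    (((measurable_lineNorm hf).comp measurable_fst).mul hkm).aemeasurable,
    hardyOp, ← lintegral_const_mul' _ _ (kernelMass_lt_top hβ).ne]
  refine setLIntegral_congr_fun measurableSet_Ioi fun v hv => ?_
  have hv : 0 < v := hv
  have hkv : Measurable fun t => k v t := hkm.comp measurable_prodMk_left
  have e3 : ∫⁻ t, k v t = ENNReal.ofReal (v ^ β) *
      (kernelMass β * ENNReal.ofReal ((y + v) ^ (-(1 + β)))) := by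
    rw [← lintegral_kernel_line β (by positivity : 0 < y + v),
      ← lintegral_const_mul' _ _ ENNReal.ofReal_ne_top]
    refine lintegral_congr fun t => ?_
    rw [hk, ← ENNReal.ofReal_mul (by positivity)]
  dsimp only
  rw [lintegral_const_mul _ hkv, e3, ENNReal.ofReal_mul (by positivity)]
  ring

/-! ### Absolute convergence, holomorphy and the norm estimate -/

theorem im_sub_conj (z w : ℂ) : (z - (starRingEnd ℂ) w).im = z.im + w.im := by simp

theorem im_le_norm_sub_conj (z : ℂ) {w : ℂ} (hw : w ∈ upper) :
    z.im ≤ ‖z - (starRingEnd ℂ) w‖ := by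
  have h := (le_abs_self _).trans (Complex.abs_im_le_norm (z - (starRingEnd ℂ) w))
  rw [im_sub_conj] at h
  have : 0 < w.im := hw
  linarith

theorem norm_sub_conj_pos {z w : ℂ} (hz : z ∈ upper) (hw : w ∈ upper) :
    0 < ‖z - (starRingEnd ℂ) w‖ :=
  lt_of_lt_of_le hz (im_le_norm_sub_conj z hw)

theorem norm_integrand_le {β : ℝ} (hβ : -1 < β) (f : ℂ → ℂ) {z z₀ w : ℂ} {C : ℝ}
    (hz₀ : z₀ ∈ upper) (hw : w ∈ upper) (hC : 0 < C)
    (h : ‖z₀ - (starRingEnd ℂ) w‖ ≤ C * ‖z - (starRingEnd ℂ) w‖) :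
    ‖integrand β f z w‖ ≤ C ^ (2 + β) * ‖integrand β f z₀ w‖ := by
  have h0 := norm_sub_conj_pos hz₀ hw
  have hw' : 0 < w.im := hw
  have h1 := Real.rpow_le_rpow_of_nonpos h0 h (by linarith : -(2 + β) ≤ 0)
  rw [Real.mul_rpow hC.le (norm_nonneg _), Real.rpow_neg hC.le] at h1
  have h2 : ‖z - (starRingEnd ℂ) w‖ ^ (-(2 + β)) ≤
      C ^ (2 + β) * ‖z₀ - (starRingEnd ℂ) w‖ ^ (-(2 + β)) := by
    rwa [inv_mul_le_iff₀ (by positivity)] at h1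
  rw [norm_integrand β f z hw, norm_integrand β f z₀ hw]
  calc ‖f w‖ * (w.im ^ β * ‖z - (starRingEnd ℂ) w‖ ^ (-(2 + β)))
      ≤ ‖f w‖ * (w.im ^ β * (C ^ (2 + β) * ‖z₀ - (starRingEnd ℂ) w‖ ^ (-(2 + β)))) := by gcongr
    _ = _ := by ring

/-- Absolute convergence of the Bergman projection at one point gives it at all points, because
`|z - w̄|` and `|z₀ - w̄|` are comparable uniformly in `w`. -/
theorem integrableOn_integrand {β : ℝ} (hβ : -1 < β) {f : ℂ → ℂ} (hf : Measurable f) {z₀ z : ℂ}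
    (hz₀ : z₀ ∈ upper) (hz : z ∈ upper) (h : absProj β f z₀ < ⊤) :
    IntegrableOn (integrand β f z) upper := by
  have hz' : 0 < z.im := hz
  have h0 : IntegrableOn (integrand β f z₀) upper :=
    ⟨(measurable_integrand β hf z₀).aestronglyMeasurable, h⟩
  set C : ℝ := 1 + ‖z₀ - z‖ / z.im
  have hC : 0 < C := by positivity
  refine Integrable.mono' (h0.norm.const_mul (C ^ (2 + β)))
    (measurable_integrand β hf z).aestronglyMeasurable ?_
  refine (ae_restrict_iff' measurableSet_upper).2 (.of_forall fun w hw => ?_)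
  refine norm_integrand_le hβ f hz₀ hw hC ?_
  have h1 := im_le_norm_sub_conj z hw
  have h2 : ‖z₀ - (starRingEnd ℂ) w‖ ≤ ‖z₀ - z‖ + ‖z - (starRingEnd ℂ) w‖ := by
    simpa using norm_add_le (z₀ - z) (z - (starRingEnd ℂ) w)
  have h3 : ‖z₀ - z‖ = ‖z₀ - z‖ / z.im * z.im := by field_simp
  have h4 : ‖z₀ - z‖ / z.im * z.im ≤ ‖z₀ - z‖ / z.im * ‖z - (starRingEnd ℂ) w‖ := by gcongr
  simp only [C]
  linarith

theorem differentiableOn_proj {β : ℝ} (hβ : -1 < β) {f : ℂ → ℂ}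
    (h : ∀ z ∈ upper, IntegrableOn (integrand β f z) upper) :
    DifferentiableOn ℂ (proj β f) upper := by
  intro z₀ hz₀
  have hy : 0 < z₀.im := hz₀
  have hb : Metric.ball z₀ (z₀.im / 2) ⊆ upper := by
    intro z hz
    have h1 := (Complex.abs_im_le_norm (z - z₀)).trans_lt (mem_ball_iff_norm.1 hz)
    rw [Complex.sub_im] at h1
    have := (abs_lt.1 h1).1
    show 0 < z.im
    linarith
  have key := hasDerivAt_integral_of_dominated_loc_of_deriv_le (𝕜 := ℂ)
    (μ := volume.restrict upper) (x₀ := z₀) (F := fun z w => integrand β f z w)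
    (F' := fun z w => -((2 + β : ℝ) : ℂ) * (integrand β f z w * (z - (starRingEnd ℂ) w)⁻¹))
    (bound := fun w => (2 + β) * (2 ^ (2 + β) * ‖integrand β f z₀ w‖ * (2 / z₀.im)))
    (Metric.ball_mem_nhds z₀ (half_pos hy)) ?_ (h z₀ hz₀) ?_ ?_ ?_ ?_
  · exact (key.2.differentiableAt.const_mul (const β)).differentiableWithinAt
  · filter_upwards [isOpen_upper.mem_nhds hz₀] with z hz using (h z hz).aestronglyMeasurable
  · have h1 : Measurable fun w : ℂ => (z₀ - (starRingEnd ℂ) w)⁻¹ :=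
      (measurable_const.sub Complex.continuous_conj.measurable).inv
    exact ((h z₀ hz₀).aestronglyMeasurable.mul h1.aestronglyMeasurable).const_mul _
  · refine (ae_restrict_iff' measurableSet_upper).2 (.of_forall fun w hw z hz => ?_)
    have h1 := im_le_norm_sub_conj z₀ hw
    have h2 : ‖z₀ - (starRingEnd ℂ) w‖ ≤ ‖z₀ - z‖ + ‖z - (starRingEnd ℂ) w‖ := by
      simpa using norm_add_le (z₀ - z) (z - (starRingEnd ℂ) w)
    have h3 : ‖z₀ - z‖ < z₀.im / 2 := by rwa [← dist_eq_norm, dist_comm]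
    have h4 := norm_integrand_le hβ f hz₀ hw two_pos (z := z) (by linarith)
    rw [norm_mul, norm_mul, norm_neg, Complex.norm_real, Real.norm_of_nonneg (by linarith),
      norm_inv]
    have h5 : ‖z - (starRingEnd ℂ) w‖⁻¹ ≤ 2 / z₀.im := by
      rw [← inv_div]
      exact inv_anti₀ (by positivity) (by linarith)
    have h6 : 0 < 2 + β := by linarith
    gcongr
  · exact (((h z₀ hz₀).norm.const_mul _).mul_const _).const_mul _
  · refine (ae_restrict_iff' measurableSet_upper).2 (.of_forall fun w hw z hz => ?_)
    have hzu : z ∈ upper := hb hz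
    have hne : z - (starRingEnd ℂ) w ≠ 0 := norm_pos_iff.1 (norm_sub_conj_pos hzu hw)
    have hs : z - (starRingEnd ℂ) w ∈ Complex.slitPlane := by
      refine Complex.mem_slitPlane_iff.2 (Or.inr ?_)
      have h1 : 0 < z.im := hzu
      have h2 : 0 < w.im := hw
      rw [im_sub_conj]
      positivity
    have hd : HasDerivAt (fun z : ℂ => (z - (starRingEnd ℂ) w) ^ (-((2 + β : ℝ) : ℂ)))
        (-((2 + β : ℝ) : ℂ) * (z - (starRingEnd ℂ) w) ^ (-((2 + β : ℝ) : ℂ) - 1) * 1) z :=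
      ((hasDerivAt_id z).sub_const _).cpow_const hs
    have e : (fun z => integrand β f z w) = fun z =>
        f w * (z - (starRingEnd ℂ) w) ^ (-((2 + β : ℝ) : ℂ)) * ((w.im ^ β : ℝ) : ℂ) := by
      funext z
      rw [integrand, Complex.cpow_neg, div_eq_mul_inv]
    rw [e]
    refine ((hd.const_mul (f w)).mul_const _).congr_deriv ?_
    rw [Complex.cpow_sub _ _ hne, Complex.cpow_one, Complex.cpow_neg, integrand]
    ring

theorem halfNorm_hardyOp_lineNorm_le {β p q r a b : ℝ} (ha : -1 < a) (hβ : -1 < β)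
    (hq : 1 < q) (hqr : q ≤ r) (hab : (a + 1) / q = (b + 1) / r) {f : ℂ → ℂ}
    (hf : Measurable f) :
    halfNorm r b (hardyOp β (lineNorm p f)) ≤
      ENNReal.ofReal (a + 1) ^ (1 / q - 1 / r) *
        ((∫⁻ l in Set.Ioi (0 : ℝ),
          ENNReal.ofReal (l ^ (β - (a + 1) / q) * (1 + l) ^ (-(1 + β)))) * mixedNorm p q a f) := by
  rw [mixedNorm_eq_halfNorm]
  refine (halfNorm_le_of_antitoneOn (by linarith) hqr ha hab
    fun y y' hy h => hardyOp_antitoneOn hβ _ hy h).trans ?_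
  gcongr
  exact halfNorm_hardyOp_le hq (measurable_lineNorm hf)

/-- The integral of the projection converges absolutely at some point: the antitone function
`hardyOp β (lineNorm p f)` has finite norm, hence finite values. -/
theorem exists_absProj_lt_top {β p q a : ℝ} (ha : -1 < a) (hβ : -1 < β) (hp : 1 < p)
    (hq : 1 < q) (h1 : a + 1 < q * (β + 1)) {f : ℂ → ℂ} (hf : Measurable f)
    (hfin : mixedNorm p q a f < ⊤) : ∃ z ∈ upper, absProj β f z < ⊤ := by
  have hq0 : 0 < q := by linarith
  have hκ := lintegral_hardy_kernel_lt_top (β := β) (γ := (a + 1) / q)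
    (div_pos (by linarith) hq0) (by rw [div_lt_iff₀ hq0]; linarith)
  have h2 : halfNorm q a (hardyOp β (lineNorm p f)) < ⊤ := by
    refine (halfNorm_hardyOp_le hq (measurable_lineNorm hf)).trans_lt ?_
    rw [← mixedNorm_eq_halfNorm]
    exact ENNReal.mul_lt_top hκ hfin
  have h3 : hardyOp β (lineNorm p f) 1 < ⊤ := by
    have h4 := rpow_mul_le_halfNorm_rpow hq0 ha
      (H := hardyOp β (lineNorm p f)) (fun y y' hy h => hardyOp_antitoneOn hβ _ hy h) one_pos
    rw [Real.one_rpow, ENNReal.ofReal_one, mul_one] at h4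
    have h5 := h4.trans_lt (ENNReal.mul_lt_top ENNReal.ofReal_lt_top
      (ENNReal.rpow_lt_top_of_nonneg hq0.le h2.ne))
    rwa [ENNReal.rpow_lt_top_iff_of_pos hq0] at h5
  by_contra! hcon
  have h6 := (lintegral_absProj_rpow_le hβ hp hf one_pos).trans_lt
    (ENNReal.mul_lt_top (kernelMass_lt_top hβ) h3)
  have h7 : ∀ x : ℝ, absProj β f ⟨x, 1⟩ = ⊤ := fun x =>
    top_le_iff.1 (hcon ⟨x, 1⟩ (show (0 : ℝ) < 1 from one_pos))
  have hp0 : 0 < p := by linarith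
  simp [h7, hp0] at h6

theorem mixedNorm_proj_le {β p q r a b : ℝ} (ha : -1 < a) (hβ : -1 < β) (hp : 1 < p)
    (hq : 1 < q) (hqr : q ≤ r) (hab : (a + 1) / q = (b + 1) / r) {f : ℂ → ℂ}
    (hf : Measurable f) :
    mixedNorm p r b (proj β f) ≤ ‖const β‖ₑ * (kernelMass β *
      (ENNReal.ofReal (a + 1) ^ (1 / q - 1 / r) *
        ((∫⁻ l in Set.Ioi (0 : ℝ),
          ENNReal.ofReal (l ^ (β - (a + 1) / q) * (1 + l) ^ (-(1 + β)))) *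
            mixedNorm p q a f))) := by
  have hr : 0 < r := by linarith
  have hp0 : 0 < p := by linarith
  rw [mixedNorm_eq_halfNorm p r]
  have h1 : ∀ y, 0 < y → lineNorm p (proj β f) y ≤
      ‖const β‖ₑ * (kernelMass β * hardyOp β (lineNorm p f) y) := by
    intro y hy
    refine le_trans ?_ (mul_le_mul_right (lintegral_absProj_rpow_le hβ hp hf hy) _)
    calc lineNorm p (proj β f) y
        ≤ (∫⁻ x : ℝ, (‖const β‖ₑ * absProj β f ⟨x, y⟩) ^ p) ^ (1 / p) := by
          refine ENNReal.rpow_le_rpow (lintegral_mono fun x => ?_) (by positivity)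
          gcongr
          exact enorm_proj_le β f _
      _ = ‖const β‖ₑ * (∫⁻ x : ℝ, absProj β f ⟨x, y⟩ ^ p) ^ (1 / p) := by
          simp only [ENNReal.mul_rpow_of_nonneg _ _ hp0.le]
          rw [lintegral_const_mul' _ _ (by simp [hp0.le]),
            ENNReal.mul_rpow_of_nonneg _ _ (by positivity), ← ENNReal.rpow_mul,
            mul_one_div_cancel hp0.ne', ENNReal.rpow_one]
  refine (halfNorm_mono hr h1).trans ?_
  rw [halfNorm_const_mul hr enorm_ne_top, halfNorm_const_mul hr (kernelMass_lt_top hβ).ne]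
  gcongr
  exact halfNorm_hardyOp_lineNorm_le ha hβ hq hqr hab hf

/-- Sufficiency of the two conditions; the estimates are for measurable functions, and the general
case follows by passing to a measurable representative, which changes neither side. -/
theorem boundedOnSpace_of_lt {β p q r a b : ℝ} (ha : -1 < a) (hβ : -1 < β) (hp : 1 < p)
    (hq : 1 < q) (hqr : q ≤ r) (h1 : a + 1 < q * (β + 1)) (hab : (a + 1) / q = (b + 1) / r) :
    BoundedOnSpace β p q r a b := by
  have hq0 : 0 < q := by linarith
  set κ := ∫⁻ l in Set.Ioi (0 : ℝ),
    ENNReal.ofReal (l ^ (β - (a + 1) / q) * (1 + l) ^ (-(1 + β)))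
  have hκ : κ < ⊤ := lintegral_hardy_kernel_lt_top
    (div_pos (by linarith) hq0) (by rw [div_lt_iff₀ hq0]; linarith)
  set C : ℝ≥0∞ := ‖const β‖ₑ * (kernelMass β * (ENNReal.ofReal (a + 1) ^ (1 / q - 1 / r) * κ))
    with hC
  have hCt : C ≠ ⊤ := by
    refine (ENNReal.mul_lt_top enorm_lt_top (ENNReal.mul_lt_top (kernelMass_lt_top hβ)
      (ENNReal.mul_lt_top (ENNReal.rpow_lt_top_of_nonneg ?_ ENNReal.ofReal_ne_top) hκ))).ne
    exact sub_nonneg.2 (one_div_le_one_div_of_le hq0 hqr)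
  refine ⟨C.toNNReal, fun f ⟨hfm, hfn⟩ => ?_⟩
  rw [ENNReal.coe_toNNReal hCt]
  set g : ℂ → ℂ := hfm.mk f with hg
  have hgm : Measurable g := hfm.stronglyMeasurable_mk.measurable
  have hfg : f =ᵐ[volume.restrict upper] g := hfm.ae_eq_mk
  have hI : ∀ z, integrand β f z =ᵐ[volume.restrict upper] integrand β g z := by
    intro z
    filter_upwards [hfg] with w hw
    simp only [integrand, hw]
  have hproj : proj β f = proj β g := by
    funext z
    rw [proj, proj, integral_congr_ae (hI z)]
  have hn : mixedNorm p q a f = mixedNorm p q a g := mixedNorm_congr_ae hfg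
  rw [hn] at hfn ⊢
  obtain ⟨z₀, hz₀, hfin⟩ := exists_absProj_lt_top ha hβ hp hq h1 hgm hfn
  have hint : ∀ z ∈ upper, IntegrableOn (integrand β g z) upper := fun z hz =>
    integrableOn_integrand hβ hgm hz₀ hz hfin
  have hle : mixedNorm p r b (proj β g) ≤ C * mixedNorm p q a g := by
    refine (mixedNorm_proj_le ha hβ hp hq hqr hab hgm).trans_eq ?_
    simp only [hC, mul_assoc, κ]
  have hd := differentiableOn_proj hβ hint
  rw [hproj]
  refine ⟨fun z hz => (hint z hz).congr (hI z).symm, ⟨hd, ?_, ?_⟩, hle⟩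
  · exact hd.continuousOn.aestronglyMeasurable measurableSet_upper
  · exact hle.trans_lt (ENNReal.mul_lt_top hCt.lt_top hfn)

/-! ### Lower bounds for the projection on test functions -/

theorem cpow_real_mul {y : ℝ} (hy : 0 < y) (z : ℂ) (s : ℝ) :
    ((y : ℂ) * z) ^ (s : ℂ) = ((y ^ s : ℝ) : ℂ) * z ^ (s : ℂ) := by
  rw [Complex.cpow_ofReal, Complex.cpow_ofReal, Complex.arg_real_mul z hy, norm_mul,
    Complex.norm_real, Real.norm_of_nonneg hy.le, Real.mul_rpow hy.le (norm_nonneg _)]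
  push_cast
  ring

/-- Up to a fixed phase the kernel has positive real part, comparable to its modulus, in a narrow
cone around the vertical direction. -/
theorem exists_re_kernel_ge (s : ℝ) : ∃ ε > 0, ∀ ζ : ℂ, ‖ζ - Complex.I‖ < ε →
    1 / 2 ≤ (Complex.I ^ (s : ℂ) / ζ ^ (s : ℂ)).re := by
  have hI : Complex.I ∈ Complex.slitPlane := by simp [Complex.mem_slitPlane_iff]
  have h0 : Complex.I ^ (s : ℂ) ≠ 0 := by simp [Complex.cpow_eq_zero_iff]
  have hc : ContinuousAt (fun ζ : ℂ => (Complex.I ^ (s : ℂ) / ζ ^ (s : ℂ)).re) Complex.I :=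
    Complex.continuous_re.continuousAt.comp
      (continuousAt_const.div (continuousAt_cpow_const hI) h0)
  have h1 : (1 / 2 : ℝ) < (Complex.I ^ (s : ℂ) / Complex.I ^ (s : ℂ)).re := by
    rw [div_self h0]; norm_num
  obtain ⟨ε, hε, h⟩ := Metric.eventually_nhds_iff.1 (hc.eventually (lt_mem_nhds h1))
  exact ⟨ε, hε, fun ζ hζ => (h (by rwa [dist_eq_norm])).le⟩

theorem integrableOn_upper_of_isTest {f F : ℂ → ℂ} (hf : IsTest f) (hF : ContinuousOn F upper)
    (h : ∀ w, f w = 0 → F w = 0) : IntegrableOn F upper := by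
  have hK : IsCompact (tsupport f) := hf.2.1
  refine ((hF.mono hf.2.2).integrableOn_compact hK).of_forall_sdiff_eq_zero measurableSet_upper ?_
  exact fun w hw => h w (image_eq_zero_of_notMem_tsupport hw.2)

theorem continuousOn_im_rpow (s : ℝ) : ContinuousOn (fun w : ℂ => ((w.im ^ s : ℝ) : ℂ)) upper := by
  refine Complex.continuous_ofReal.comp_continuousOn ?_
  exact Complex.continuous_im.continuousOn.rpow_const fun w hw => Or.inl (ne_of_gt hw)

theorem IsTest.integrableOn_integrand {f : ℂ → ℂ} (hf : IsTest f) (β : ℝ) {z : ℂ}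
    (hz : z ∈ upper) : IntegrableOn (integrand β f z) upper := by
  refine integrableOn_upper_of_isTest hf ?_ (fun w hw => by simp [integrand, hw])
  refine (hf.1.continuous.continuousOn.div (ContinuousOn.cpow_const ?_ ?_) ?_).mul
    (continuousOn_im_rpow β)
  · exact (continuous_const.sub Complex.continuous_conj).continuousOn
  · intro w hw
    refine Complex.mem_slitPlane_iff.2 (Or.inr ?_)
    have h1 : 0 < z.im := hz
    have h2 : 0 < w.im := hw
    rw [im_sub_conj]
    positivity
  · intro w hw
    rw [Ne, Complex.cpow_eq_zero_iff]
    exact fun h => norm_pos_iff.1 (norm_sub_conj_pos hz hw) h.1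

theorem IsTest.integrableOn_mul_im_rpow {g : ℂ → ℝ} (hg : IsTest (fun w => (g w : ℂ))) (s : ℝ) :
    IntegrableOn (fun w => g w * w.im ^ s) upper := by
  have h1 : IntegrableOn (fun w => (g w : ℂ) * ((w.im ^ s : ℝ) : ℂ)) upper :=
    integrableOn_upper_of_isTest hg
      (hg.1.continuous.continuousOn.mul (continuousOn_im_rpow s)) (fun w hw => by
        rw [show (g w : ℂ) = 0 from hw, zero_mul])
  refine h1.re.congr (.of_forall fun w => ?_)
  simp only [← Complex.ofReal_mul]
  exact Complex.ofReal_re _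

/-- Lower bound for the Bergman projection of a nonnegative function supported in a box of
side `4 t`, at points above the box whose height is a large multiple of `t`. -/
theorem exists_norm_proj_ge {β : ℝ} (hβ : -1 < β) : ∃ M > 0, ∃ c > 0, ∀ t > 0, ∀ g : ℂ → ℝ,
    IsTest (fun w => (g w : ℂ)) → (∀ w, 0 ≤ g w) →
    (∀ w, g w ≠ 0 → |w.re| ≤ 2 * t ∧ w.im ≤ 2 * t) →
    ∀ x y : ℝ, |x| ≤ 2 * t → M * t ≤ y → y ≤ 2 * M * t →
      c * t ^ (-(2 + β)) * ∫ w in upper, g w * w.im ^ β ≤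
        ‖proj β (fun w => (g w : ℂ)) ⟨x, y⟩‖ := by
  obtain ⟨ε, hε, hker⟩ := exists_re_kernel_ge (2 + β)
  have hc0 : 0 < ‖const β‖ := by
    rw [norm_pos_iff, const]
    refine mul_ne_zero (Complex.ofReal_ne_zero.2 (ne_of_gt ?_)) (Complex.exp_ne_zero _)
    have : 0 < β + 1 := by linarith
    positivity
  -- For `Im z ≥ 7 t / ε` the point `(z - w̄) / Im z` is within `6 t / Im z < ε` of `i`.
  refine ⟨7 / ε, by positivity, ‖const β‖ * (2⁻¹ * (2 * (7 / ε)) ^ (-(2 + β))), by positivity, ?_⟩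
  intro t ht g hg hg0 hsupp x y hx hy1 hy2
  have hy : 0 < y := lt_of_lt_of_le (by positivity) hy1
  have hz : (⟨x, y⟩ : ℂ) ∈ upper := hy
  set f : ℂ → ℂ := fun w => (g w : ℂ) with hf
  have hint := hg.integrableOn_integrand β hz
  have hint2 := hg.integrableOn_mul_im_rpow β
  have hpt : ∀ w ∈ upper, 2⁻¹ * y ^ (-(2 + β)) * (g w * w.im ^ β) ≤
      (Complex.I ^ ((2 + β : ℝ) : ℂ) * integrand β f ⟨x, y⟩ w).re := by
    intro w hw
    have hw' : 0 < w.im := hw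
    by_cases h0 : g w = 0
    · simp [integrand, hf, h0]
    obtain ⟨h1, h2⟩ := hsupp w h0
    set ζ : ℂ := ⟨(x - w.re) / y, (y + w.im) / y⟩ with hζ
    have e : (⟨x, y⟩ : ℂ) - (starRingEnd ℂ) w = (y : ℂ) * ζ := by
      apply Complex.ext <;> simp [hζ] <;> field_simp
    have hn : ‖ζ - Complex.I‖ < ε := by
      refine (Complex.norm_le_abs_re_add_abs_im _).trans_lt ?_
      have e1 : (ζ - Complex.I).re = (x - w.re) / y := by simp [hζ]
      have e2 : (ζ - Complex.I).im = w.im / y := by simp [hζ]; field_simp; ring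
      rw [e1, e2, abs_div, abs_div, abs_of_pos hy, ← add_div, div_lt_iff₀ hy, abs_of_pos hw']
      have h3 : |x - w.re| ≤ |x| + |w.re| := abs_sub _ _
      have h4 : ε * (7 / ε * t) ≤ ε * y := by gcongr
      have h5 : ε * (7 / ε * t) = 7 * t := by field_simp
      linarith
    have h6 := hker ζ hn
    have e3 : Complex.I ^ ((2 + β : ℝ) : ℂ) * integrand β f ⟨x, y⟩ w =
        ((y ^ (-(2 + β)) * (g w * w.im ^ β) : ℝ) : ℂ) *
          (Complex.I ^ ((2 + β : ℝ) : ℂ) / ζ ^ ((2 + β : ℝ) : ℂ)) := by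
      rw [integrand, e, cpow_real_mul hy, Real.rpow_neg hy.le]
      simp only [hf, Complex.ofReal_mul, Complex.ofReal_inv, div_eq_mul_inv, mul_inv]
      ring
    rw [e3, Complex.re_ofReal_mul]
    have h7 : 0 ≤ y ^ (-(2 + β)) * (g w * w.im ^ β) :=
      mul_nonneg (by positivity) (mul_nonneg (hg0 w) (by positivity))
    calc 2⁻¹ * y ^ (-(2 + β)) * (g w * w.im ^ β)
        = y ^ (-(2 + β)) * (g w * w.im ^ β) * (1 / 2) := by ring
      _ ≤ _ := by gcongr
  have hI0 : 0 ≤ ∫ w in upper, g w * w.im ^ β :=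
    setIntegral_nonneg measurableSet_upper fun w hw =>
      mul_nonneg (hg0 w) (Real.rpow_nonneg (le_of_lt hw) _)
  have hre : 2⁻¹ * y ^ (-(2 + β)) * ∫ w in upper, g w * w.im ^ β ≤
      ‖∫ w in upper, integrand β f ⟨x, y⟩ w‖ := by
    have hint' : IntegrableOn
        (fun w => Complex.I ^ ((2 + β : ℝ) : ℂ) * integrand β f ⟨x, y⟩ w) upper :=
      hint.const_mul _
    calc 2⁻¹ * y ^ (-(2 + β)) * ∫ w in upper, g w * w.im ^ β
        = ∫ w in upper, 2⁻¹ * y ^ (-(2 + β)) * (g w * w.im ^ β) := (integral_const_mul _ _).symm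
      _ ≤ ∫ w in upper, (Complex.I ^ ((2 + β : ℝ) : ℂ) * integrand β f ⟨x, y⟩ w).re :=
          setIntegral_mono_on (hint2.const_mul _) hint'.re measurableSet_upper hpt
      _ = (∫ w in upper, Complex.I ^ ((2 + β : ℝ) : ℂ) * integrand β f ⟨x, y⟩ w).re :=
          integral_re hint'
      _ ≤ ‖∫ w in upper, Complex.I ^ ((2 + β : ℝ) : ℂ) * integrand β f ⟨x, y⟩ w‖ :=
          Complex.re_le_norm _
      _ = _ := by
          rw [integral_const_mul, norm_mul, Complex.norm_cpow_real, Complex.norm_I,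
            Real.one_rpow, one_mul]
  rw [proj, norm_mul]
  refine le_trans ?_ (mul_le_mul_of_nonneg_left hre (norm_nonneg _))
  have h8 : (2 * (7 / ε)) ^ (-(2 + β)) * t ^ (-(2 + β)) ≤ y ^ (-(2 + β)) := by
    rw [← Real.mul_rpow (by positivity) ht.le]
    exact Real.rpow_le_rpow_of_nonpos hy hy2 (by linarith)
  calc _ = ‖const β‖ * (2⁻¹ * ((2 * (7 / ε)) ^ (-(2 + β)) * t ^ (-(2 + β))) *
        ∫ w in upper, g w * w.im ^ β) := by ring
    _ ≤ _ := by gcongr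

/-- Smooth cut-offs of `(Im w) ^ s`, equal to it on the box `[-t, t] × [δ, t]` and supported in a box
of twice the size. -/
theorem exists_isTest_cutoff (s : ℝ) {t δ : ℝ} (hδ : 0 < δ) (hδt : δ ≤ t) :
    ∃ g : ℂ → ℝ, IsTest (fun w => (g w : ℂ)) ∧ (∀ w, 0 ≤ g w) ∧
      (∀ w, g w ≠ 0 → |w.re| ≤ 2 * t ∧ δ / 2 ≤ w.im ∧ w.im ≤ 2 * t) ∧
      (∀ w ∈ upper, g w ≤ w.im ^ s) ∧
      (∀ w, |w.re| ≤ t → δ ≤ w.im → w.im ≤ t → g w = w.im ^ s) := by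
  have ht : 0 < t := hδ.trans_le hδt
  set U : Set ℂ := {w | |w.re| < 2 * t ∧ δ / 2 < w.im ∧ w.im < 2 * t} with hU
  set B : Set ℂ := {w | |w.re| ≤ 2 * t ∧ δ / 2 ≤ w.im ∧ w.im ≤ 2 * t} with hB
  set K : Set ℂ := {w | |w.re| ≤ t ∧ δ ≤ w.im ∧ w.im ≤ t} with hK
  have hre := Complex.continuous_re
  have him := Complex.continuous_im
  have hUo : IsOpen U := (isOpen_lt hre.abs continuous_const).inter
    ((isOpen_lt continuous_const him).inter (isOpen_lt him continuous_const))
  have hBc : IsClosed B := (isClosed_le hre.abs continuous_const).inter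
    ((isClosed_le continuous_const him).inter (isClosed_le him continuous_const))
  have hKc : IsClosed K := (isClosed_le hre.abs continuous_const).inter
    ((isClosed_le continuous_const him).inter (isClosed_le him continuous_const))
  have hBb : B ⊆ Metric.closedBall 0 (2 * t + 2 * t) := by
    intro w hw
    rw [mem_closedBall_zero_iff]
    refine (Complex.norm_le_abs_re_add_abs_im w).trans ?_
    rw [abs_of_pos (lt_of_lt_of_le (half_pos hδ) hw.2.1)]
    exact add_le_add hw.1 hw.2.2
  have hBcomp : IsCompact B := (isCompact_closedBall _ _).of_isClosed_subset hBc hBb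
  have hBu : B ⊆ upper := fun w hw => lt_of_lt_of_le (half_pos hδ) hw.2.1
  have hdisj : Disjoint Uᶜ K := by
    rw [Set.disjoint_compl_left_iff_subset]
    exact fun w hw => ⟨by linarith [hw.1], by linarith [hw.2.1], by linarith [hw.2.2]⟩
  obtain ⟨χ, hχ0, hχ1, hχ⟩ := exists_contMDiffMap_zero_one_of_isClosed
    (modelWithCornersSelf ℝ ℂ) (n := ⊤) hUo.isClosed_compl hKc hdisj
  have hχs : ContDiff ℝ (⊤ : ℕ∞) χ := contMDiff_iff_contDiff.1 χ.contMDiff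
  have hsuppχ : ∀ w, χ w ≠ 0 → w ∈ B := by
    intro w hw
    by_contra hwB
    refine hw (hχ0 fun hwU => hwB ⟨hwU.1.le, hwU.2.1.le, hwU.2.2.le⟩)
  have hts : tsupport (fun w => ((χ w * w.im ^ s : ℝ) : ℂ)) ⊆ B := by
    refine closure_minimal (fun w hw => hsuppχ w ?_) hBc
    rintro h
    exact hw (by simp [h])
  refine ⟨fun w => χ w * w.im ^ s, ⟨?_, ?_, hts.trans hBu⟩, ?_, ?_, ?_, ?_⟩
  · refine contDiff_iff_contDiffAt.2 fun w => ?_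
    by_cases hw : w ∈ B
    · have h1 : ContDiffAt ℝ (⊤ : ℕ∞) (fun w : ℂ => w.im) w := Complex.imCLM.contDiff.contDiffAt
      have h2 := hχs.contDiffAt.mul (h1.rpow_const_of_ne (p := s) (ne_of_gt (hBu hw)))
      exact Complex.ofRealCLM.contDiff.contDiffAt.comp w h2
    · have h1 : w ∉ tsupport (fun w => ((χ w * w.im ^ s : ℝ) : ℂ)) := fun h => hw (hts h)
      exact contDiffAt_const.congr_of_eventuallyEq (notMem_tsupport_iff_eventuallyEq.1 h1)
  · exact hBcomp.of_isClosed_subset (isClosed_tsupport _) hts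
  · intro w
    by_cases hw : χ w = 0
    · simp [hw]
    · exact mul_nonneg (hχ w).1 (Real.rpow_nonneg (le_of_lt (hBu (hsuppχ w hw))) _)
  · exact fun w hw => hsuppχ w (left_ne_zero_of_mul hw)
  · exact fun w hw => mul_le_of_le_one_left (Real.rpow_nonneg (le_of_lt hw) _) (hχ w).2
  · intro w h1 h2 h3
    simp [hχ1 (show w ∈ K from ⟨h1, h2, h3⟩)]

/-! ### Norms of functions supported in boxes and necessity of the conditions -/

theorem lineNorm_le {p R : ℝ} (hp : 0 < p) {f : ℂ → ℂ} {v : ℝ} {ψ : ℝ≥0∞}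
    (h : ∀ u, ‖f ⟨u, v⟩‖ₑ ≤ ψ) (h0 : ∀ u, R < |u| → f ⟨u, v⟩ = 0) :
    lineNorm p f v ≤ ENNReal.ofReal (2 * R) ^ (1 / p) * ψ := by
  have h1 : ∫⁻ u : ℝ, ‖f ⟨u, v⟩‖ₑ ^ p ≤ ENNReal.ofReal (2 * R) * ψ ^ p := by
    calc ∫⁻ u : ℝ, ‖f ⟨u, v⟩‖ₑ ^ p
        ≤ ∫⁻ u : ℝ, (Set.Icc (-R) R).indicator (fun _ => ψ ^ p) u := by
          refine lintegral_mono fun u => ?_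
          by_cases hu : u ∈ Set.Icc (-R) R
          · rw [Set.indicator_of_mem hu]
            gcongr
            exact h u
          · rw [h0 u (not_le.1 fun h' => hu (abs_le.1 h'))]
            simp [hp]
      _ = _ := by
          rw [lintegral_indicator_const measurableSet_Icc, Real.volume_Icc, mul_comm]
          ring_nf
  refine (ENNReal.rpow_le_rpow h1 (by positivity)).trans_eq ?_
  rw [ENNReal.mul_rpow_of_nonneg _ _ (by positivity), ← ENNReal.rpow_mul,
    mul_one_div_cancel hp.ne', ENNReal.rpow_one]

theorem le_lineNorm {p R : ℝ} (hp : 0 < p) {f : ℂ → ℂ} {v : ℝ} {ψ : ℝ≥0∞}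
    (h : ∀ u, |u| ≤ R → ψ ≤ ‖f ⟨u, v⟩‖ₑ) :
    ENNReal.ofReal (2 * R) ^ (1 / p) * ψ ≤ lineNorm p f v := by
  have h1 : ENNReal.ofReal (2 * R) * ψ ^ p ≤ ∫⁻ u : ℝ, ‖f ⟨u, v⟩‖ₑ ^ p := by
    calc ENNReal.ofReal (2 * R) * ψ ^ p
        = ∫⁻ u : ℝ, (Set.Icc (-R) R).indicator (fun _ => ψ ^ p) u := by
          rw [lintegral_indicator_const measurableSet_Icc, Real.volume_Icc, mul_comm]
          ring_nf
      _ ≤ _ := by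
          refine lintegral_mono fun u => ?_
          by_cases hu : u ∈ Set.Icc (-R) R
          · rw [Set.indicator_of_mem hu]
            gcongr
            exact h u (abs_le.2 hu)
          · simp [hu]
  refine le_trans (le_of_eq ?_) (ENNReal.rpow_le_rpow h1 (by positivity))
  rw [ENNReal.mul_rpow_of_nonneg _ _ (by positivity), ← ENNReal.rpow_mul,
    mul_one_div_cancel hp.ne', ENNReal.rpow_one]

theorem integrableOn_Icc_rpow (s : ℝ) {l m : ℝ} (hl : 0 < l) :
    IntegrableOn (fun v : ℝ => v ^ s) (Set.Icc l m) :=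
  (continuousOn_id.rpow_const fun _ hv =>
    Or.inl (ne_of_gt (hl.trans_le hv.1))).integrableOn_compact isCompact_Icc

theorem halfNorm_indicator_rpow {q : ℝ} (hq : 0 < q) (a s : ℝ) {k l m : ℝ} (hk : 0 ≤ k)
    (hl : 0 < l) :
    halfNorm q a ((Set.Icc l m).indicator fun v => ENNReal.ofReal (k * v ^ s)) =
      ENNReal.ofReal (k * (∫ v in Set.Icc l m, v ^ (s * q + a)) ^ (1 / q)) := by
  have h1 : ∀ v ∈ Set.Ioi (0 : ℝ),
      ((Set.Icc l m).indicator fun v => ENNReal.ofReal (k * v ^ s)) v ^ q *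
        ENNReal.ofReal (v ^ a) =
      ((Set.Icc l m).indicator fun v =>
        ENNReal.ofReal (k ^ q) * ENNReal.ofReal (v ^ (s * q + a))) v := by
    intro v hv
    have hv : 0 < v := hv
    by_cases hv' : v ∈ Set.Icc l m
    · rw [Set.indicator_of_mem hv', Set.indicator_of_mem hv',
        ENNReal.ofReal_rpow_of_nonneg (by positivity) hq.le, Real.mul_rpow hk (by positivity),
        ← ENNReal.ofReal_mul (by positivity), ← ENNReal.ofReal_mul (by positivity),
        Real.rpow_add hv, Real.rpow_mul hv.le, mul_assoc]
    · simp [hv', hq]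
  have hnn : ∀ᵐ v ∂volume.restrict (Set.Icc l m), 0 ≤ v ^ (s * q + a) :=
    (ae_restrict_iff' measurableSet_Icc).2 (.of_forall fun v hv =>
      Real.rpow_nonneg (hl.le.trans hv.1) _)
  have hI : 0 ≤ ∫ v in Set.Icc l m, v ^ (s * q + a) := integral_nonneg_of_ae hnn
  have hsub : Set.Icc l m ⊆ Set.Ioi 0 := fun v hv => hl.trans_le hv.1
  rw [halfNorm, setLIntegral_congr_fun measurableSet_Ioi h1,
    setLIntegral_indicator measurableSet_Icc, Set.inter_eq_left.2 hsub,
    lintegral_const_mul' _ _ ENNReal.ofReal_ne_top,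
    ← ofReal_integral_eq_lintegral_ofReal (integrableOn_Icc_rpow _ hl) hnn,
    ← ENNReal.ofReal_mul (by positivity), ENNReal.ofReal_rpow_of_nonneg (by positivity)
      (by positivity), Real.mul_rpow (by positivity) hI, ← Real.rpow_mul hk,
    mul_one_div_cancel hq.ne', Real.rpow_one]

theorem IsTest.memL {f : ℂ → ℂ} (hf : IsTest f) {p q : ℝ} (hp : 0 < p) (hq : 0 < q) (a : ℝ) :
    MemL p q a f := by
  refine ⟨hf.1.continuous.aestronglyMeasurable, ?_⟩
  have hK : IsCompact (tsupport f) := hf.2.1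
  obtain ⟨B, hB⟩ := hf.1.continuous.bounded_above_of_compact_support hf.2.1
  obtain ⟨R, hR⟩ := hK.isBounded.exists_norm_le
  obtain ⟨l, hl, hlK⟩ : ∃ l > 0, ∀ w ∈ tsupport f, l ≤ w.im := by
    rcases (tsupport f).eq_empty_or_nonempty with h | h
    · exact ⟨1, one_pos, by simp [h]⟩
    · obtain ⟨w, hw, hmin⟩ := hK.exists_isMinOn h Complex.continuous_im.continuousOn
      exact ⟨w.im, hf.2.2 hw, fun z hz => hmin hz⟩
  have hB0 : 0 ≤ B := (norm_nonneg _).trans (hB 0)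
  have h0 : ∀ w, f w ≠ 0 → |w.re| ≤ R ∧ w.im ∈ Set.Icc l R := by
    intro w hw
    have hwK : w ∈ tsupport f := subset_tsupport f hw
    exact ⟨(Complex.abs_re_le_norm w).trans (hR w hwK), hlK w hwK,
      (le_abs_self _).trans ((Complex.abs_im_le_norm w).trans (hR w hwK))⟩
  have h1 : ∀ v, 0 < v → lineNorm p f v ≤ ENNReal.ofReal (2 * R) ^ (1 / p) *
      ((Set.Icc l R).indicator fun v => ENNReal.ofReal (B * v ^ (0 : ℝ))) v := by
    refine fun v _ => lineNorm_le hp (fun u => ?_) fun u hu => ?_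
    · by_cases hw : f ⟨u, v⟩ = 0
      · simp [hw]
      · rw [Set.indicator_of_mem (h0 _ hw).2, ← ofReal_norm, Real.rpow_zero, mul_one]
        exact ENNReal.ofReal_le_ofReal (hB _)
    · by_contra hw
      exact (not_le.2 hu) (h0 _ hw).1
  rw [mixedNorm_eq_halfNorm]
  refine (halfNorm_mono hq h1).trans_lt ?_
  have hct : ENNReal.ofReal (2 * R) ^ (1 / p) ≠ ⊤ :=
    ENNReal.rpow_ne_top_of_nonneg (by positivity) ENNReal.ofReal_ne_top
  rw [halfNorm_const_mul hq hct, halfNorm_indicator_rpow hq a 0 hB0 hl]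
  exact ENNReal.mul_lt_top hct.lt_top ENNReal.ofReal_lt_top

theorem BoundedOnSpace.boundedOnTest {β p q r a b : ℝ} (hp : 0 < p) (hq : 0 < q)
    (h : BoundedOnSpace β p q r a b) : BoundedOnTest β p q r a b := by
  obtain ⟨C, hC⟩ := h
  exact ⟨C, fun f hf => (hC f (hf.memL hp hq a)).2⟩

/-- The pairing of a cut-off of `(Im w) ^ (-(β + 1))` with `(Im w) ^ β` grows logarithmically. -/
theorem mul_log_le_integral {β t δ : ℝ} (hδ : 0 < δ) (hδt : δ ≤ t) {g : ℂ → ℝ}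
    (hg : IsTest (fun w => (g w : ℂ))) (hg0 : ∀ w, 0 ≤ g w)
    (hgK : ∀ w, |w.re| ≤ t → δ ≤ w.im → w.im ≤ t → g w = w.im ^ (-(β + 1))) :
    2 * t * Real.log (t / δ) ≤ ∫ w in upper, g w * w.im ^ β := by
  have ht : 0 < t := hδ.trans_le hδt
  have hnn : ∀ᵐ w ∂volume.restrict upper, 0 ≤ g w * w.im ^ β :=
    (ae_restrict_iff' measurableSet_upper).2 (.of_forall fun w hw =>
      mul_nonneg (hg0 w) (Real.rpow_nonneg (le_of_lt hw) _))
  have hgc : Continuous g := Complex.continuous_re.comp hg.1.continuous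
  have hm : Measurable fun w => ENNReal.ofReal (g w * w.im ^ β) :=
    (hgc.measurable.mul (Complex.measurable_im.pow_const β)).ennreal_ofReal
  rw [← ENNReal.ofReal_le_ofReal_iff (integral_nonneg_of_ae hnn),
    ofReal_integral_eq_lintegral_ofReal (hg.integrableOn_mul_im_rpow β) hnn, setLIntegral_upper hm]
  have hlog : ENNReal.ofReal (Real.log (t / δ)) =
      ∫⁻ v in Set.Icc δ t, ENNReal.ofReal v⁻¹ := by
    have hi : IntegrableOn (fun v : ℝ => v⁻¹) (Set.Icc δ t) := by
      simpa only [Real.rpow_neg_one] using integrableOn_Icc_rpow (-1) (m := t) hδ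
    rw [← ofReal_integral_eq_lintegral_ofReal hi
      ((ae_restrict_iff' measurableSet_Icc).2 (.of_forall fun v hv =>
        inv_nonneg.2 (hδ.le.trans hv.1))), integral_Icc_eq_integral_Ioc,
      ← intervalIntegral.integral_of_le hδt, integral_inv_of_pos hδ ht]
  rw [ENNReal.ofReal_mul (by positivity), hlog, ← lintegral_const_mul' _ _ ENNReal.ofReal_ne_top]
  refine (setLIntegral_mono' measurableSet_Icc fun v hv => ?_).trans
    (lintegral_mono_set fun v hv => hδ.trans_le hv.1)
  have hv0 : 0 < v := hδ.trans_le hv.1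
  calc ENNReal.ofReal (2 * t) * ENNReal.ofReal v⁻¹
      = ∫⁻ u in Set.Icc (-t) t, ENNReal.ofReal v⁻¹ := by
        rw [setLIntegral_const, Real.volume_Icc, mul_comm]
        ring_nf
    _ ≤ ∫⁻ u in Set.Icc (-t) t, ENNReal.ofReal (g ⟨u, v⟩ * v ^ β) := by
        refine setLIntegral_mono' measurableSet_Icc fun u hu => ENNReal.ofReal_le_ofReal ?_
        rw [hgK ⟨u, v⟩ (abs_le.2 hu) hv.1 hv.2, ← Real.rpow_add hv0, ← Real.rpow_neg_one]
        ring_nf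
        exact le_rfl
    _ ≤ _ := setLIntegral_le_lintegral _ _

/-- What boundedness says about the cut-offs of `(Im w) ^ (-(β + 1))`: the factors coming from the
horizontal variable cancel, and an inequality between one-dimensional integrals remains. -/
theorem BoundedOnTest.exists_mul_log_le {β p q r a b : ℝ} (hb : -1 < b) (hβ : -1 < β)
    (hp : 0 < p) (hq : 0 < q) (hr : 0 < r) (h : BoundedOnTest β p q r a b) :
    ∃ C : ℝ, ∀ t δ : ℝ, 0 < δ → δ ≤ t → t ^ ((b + 1) / r - (β + 1)) * Real.log (t / δ) ≤
      C * (∫ v in Set.Icc (δ / 2) (2 * t), v ^ (-(β + 1) * q + a)) ^ (1 / q) := by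
  obtain ⟨C, hC⟩ := h
  obtain ⟨M, hM, c, hc, hlow⟩ := exists_norm_proj_ge hβ
  set D : ℝ := ((2 * M) ^ (b + 1) - M ^ (b + 1)) / (b + 1) with hD
  have hD0 : 0 < D := by
    refine div_pos (sub_pos.2 (Real.rpow_lt_rpow hM.le ?_ ?_)) ?_ <;> linarith
  refine ⟨C / (2 * c * D ^ (1 / r)), fun t δ hδ hδt => ?_⟩
  have ht : 0 < t := hδ.trans_le hδt
  have hlog : 0 ≤ Real.log (t / δ) := Real.log_nonneg (by rwa [le_div_iff₀ hδ, one_mul])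
  obtain ⟨g, hg, hg0, hgs, hgu, hgK⟩ := exists_isTest_cutoff (-(β + 1)) hδ hδt
  set k : ℝ := c * t ^ (-(2 + β)) * (2 * t * Real.log (t / δ)) with hk
  have hk0 : 0 ≤ k := by positivity
  have hproj : ∀ x y : ℝ, |x| ≤ 2 * t → y ∈ Set.Icc (M * t) (2 * M * t) →
      k ≤ ‖proj β (fun w => (g w : ℂ)) ⟨x, y⟩‖ := by
    intro x y hx hy
    refine le_trans ?_ (hlow t ht g hg hg0 (fun w hw => ⟨(hgs w hw).1, (hgs w hw).2.2⟩) x y hx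
      hy.1 hy.2)
    exact mul_le_mul_of_nonneg_left (mul_log_le_integral hδ hδt hg hg0 hgK) (by positivity)
  set A : ℝ≥0∞ := ENNReal.ofReal (2 * (2 * t)) ^ (1 / p) with hA
  have hA0 : A ≠ 0 := by simp [hA, ENNReal.rpow_eq_zero_iff, ht, hp.not_gt]
  have hAt : A ≠ ⊤ := ENNReal.rpow_ne_top_of_nonneg (by positivity) ENNReal.ofReal_ne_top
  have hL : A * ENNReal.ofReal
      (k * (∫ v in Set.Icc (M * t) (2 * M * t), v ^ (0 * r + b)) ^ (1 / r)) ≤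
      mixedNorm p r b (proj β fun w => (g w : ℂ)) := by
    rw [← halfNorm_indicator_rpow hr b 0 hk0 (by positivity), ← halfNorm_const_mul hr hAt,
      mixedNorm_eq_halfNorm]
    refine halfNorm_mono hr fun y _ => le_lineNorm hp fun x hx => ?_
    by_cases hy : y ∈ Set.Icc (M * t) (2 * M * t)
    · rw [Set.indicator_of_mem hy, Real.rpow_zero, mul_one, ← ofReal_norm]
      exact ENNReal.ofReal_le_ofReal (hproj x y hx hy)
    · simp [hy]
  have hU : mixedNorm p q a (fun w => (g w : ℂ)) ≤ A * ENNReal.ofReal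
      (1 * (∫ v in Set.Icc (δ / 2) (2 * t), v ^ (-(β + 1) * q + a)) ^ (1 / q)) := by
    rw [← halfNorm_indicator_rpow hq a _ zero_le_one (by positivity), ← halfNorm_const_mul hq hAt,
      mixedNorm_eq_halfNorm]
    refine halfNorm_mono hq fun v hv => lineNorm_le hp (fun u => ?_) fun u hu => ?_
    · by_cases hw : g ⟨u, v⟩ = 0
      · simp [hw]
      · rw [Set.indicator_of_mem (show v ∈ Set.Icc (δ / 2) (2 * t) from (hgs _ hw).2),
          ← ofReal_norm, one_mul, Complex.norm_real, Real.norm_of_nonneg (hg0 _)]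
        exact ENNReal.ofReal_le_ofReal (hgu _ hv)
    · by_contra hw
      exact (not_le.2 hu) (hgs _ (by simpa using hw)).1
  have hfin : A * ENNReal.ofReal
      (k * (∫ v in Set.Icc (M * t) (2 * M * t), v ^ (0 * r + b)) ^ (1 / r)) ≤
      A * ENNReal.ofReal (C *
        (1 * (∫ v in Set.Icc (δ / 2) (2 * t), v ^ (-(β + 1) * q + a)) ^ (1 / q))) := by
    refine hL.trans ((hC _ hg).2.trans ((mul_le_mul_right hU _).trans_eq ?_))
    rw [ENNReal.ofReal_mul (p := (C : ℝ)) C.2, ENNReal.ofReal_coe_nnreal, mul_left_comm]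
  have hJ : 0 ≤ ∫ v in Set.Icc (δ / 2) (2 * t), v ^ (-(β + 1) * q + a) :=
    setIntegral_nonneg measurableSet_Icc fun v hv =>
      Real.rpow_nonneg ((half_pos hδ).le.trans hv.1) _
  rw [ENNReal.mul_le_mul_iff_right hA0 hAt, ENNReal.ofReal_le_ofReal_iff (by positivity),
    zero_mul, zero_add, one_mul, integral_Icc_eq_integral_Ioc,
    ← intervalIntegral.integral_of_le (by nlinarith [mul_pos hM ht]),
    integral_rpow (Or.inl hb), Real.mul_rpow (by positivity) ht.le, Real.mul_rpow hM.le ht.le,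
    ← sub_mul, mul_div_right_comm, ← hD, Real.mul_rpow hD0.le (by positivity),
    ← Real.rpow_mul ht.le] at hfin
  rw [div_mul_eq_mul_div, le_div_iff₀ (by positivity)]
  refine le_trans (le_of_eq ?_) hfin
  have e : t ^ ((b + 1) / r - (β + 1)) = t ^ (-(2 + β)) * t * t ^ ((b + 1) * (1 / r)) := by
    nth_rewrite 3 [← Real.rpow_one t]
    rw [← Real.rpow_add ht, ← Real.rpow_add ht]
    congr 1
    ring
  rw [e, hk]
  ring

/-- Dilating a fixed cut-off forces the homogeneities of the two norms to agree. -/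
theorem BoundedOnTest.homogeneity {β p q r a b : ℝ} (hb : -1 < b) (hβ : -1 < β)
    (hp : 0 < p) (hq : 0 < q) (hr : 0 < r) (h : BoundedOnTest β p q r a b) :
    (a + 1) / q = (b + 1) / r := by
  obtain ⟨C, hC⟩ := h.exists_mul_log_le hb hβ hp hq hr
  set s := -(β + 1) * q + a with hs
  set D := ∫ v in (1 / 4 : ℝ)..2, v ^ s
  have hD : 0 ≤ D := intervalIntegral.integral_nonneg (by norm_num) fun v hv =>
    Real.rpow_nonneg (by linarith [hv.1]) _
  have hlog : 0 < Real.log 2 := Real.log_pos one_lt_two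
  set e := (b + 1) / r - (a + 1) / q with he
  have key : ∀ t : ℝ, 0 < t → t ^ e ≤ C * D ^ (1 / q) / Real.log 2 := by
    intro t ht
    have h1 := hC t (t / 2) (by positivity) (by linarith)
    have h2 : ∫ v in Set.Icc (t / 2 / 2) (2 * t), v ^ s = t ^ (s + 1) * D := by
      have h3 := intervalIntegral.integral_comp_mul_left (a := 1 / 4) (b := 2)
        (fun v : ℝ => v ^ s) ht.ne'
      have h4 : ∫ v in (1 / 4 : ℝ)..2, (t * v) ^ s = t ^ s * D := by
        rw [← intervalIntegral.integral_const_mul]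
        refine intervalIntegral.integral_congr fun v hv => ?_
        rw [Set.uIcc_of_le (by norm_num)] at hv
        exact Real.mul_rpow ht.le (by linarith [hv.1])
      rw [h4] at h3
      rw [integral_Icc_eq_integral_Ioc, ← intervalIntegral.integral_of_le (by linarith),
        Real.rpow_add ht, Real.rpow_one, mul_right_comm, h3, smul_eq_mul, mul_comm t 2,
        show t * (1 / 4) = t / 2 / 2 by ring]
      field_simp
    rw [h2, show t / (t / 2) = 2 by field_simp, Real.mul_rpow (by positivity) hD,
      ← Real.rpow_mul ht.le] at h1
    have h5 : t ^ ((b + 1) / r - (β + 1)) = t ^ e * t ^ ((s + 1) * (1 / q)) := by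
      rw [← Real.rpow_add ht]
      congr 1
      rw [he, hs]
      field_simp
      ring
    rw [le_div_iff₀ hlog]
    have h6 : 0 < t ^ ((s + 1) * (1 / q)) := by positivity
    rw [h5] at h1
    nlinarith
  by_contra hne
  have he0 : e ≠ 0 := fun h0 => hne (by linarith)
  -- A nonzero power of `t` is unbounded on `(0, ∞)`: evaluate at `t = X ^ (1 / e)` for large `X`.
  set B := C * D ^ (1 / q) / Real.log 2
  have hX : 0 < |B| + 1 := by positivity
  have h1 := key ((|B| + 1) ^ (1 / e)) (by positivity)
  rw [← Real.rpow_mul hX.le, one_div_mul_cancel he0, Real.rpow_one] at h1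
  linarith [le_abs_self B]

/-- Cut-offs of the extremal power `(Im w) ^ (-(β + 1))` rule out `a + 1 ≥ q (β + 1)`: as the
cut-off at the boundary is removed, the norm of the image grows like `X` and that of the function
at most like `X ^ (1 / q)`, where `X` is the logarithm of the inverse cut-off height. -/
theorem BoundedOnTest.lt_mul {β p q r a b : ℝ} (hb : -1 < b) (hβ : -1 < β)
    (hp : 0 < p) (hq : 1 < q) (hr : 0 < r) (h : BoundedOnTest β p q r a b) :
    a + 1 < q * (β + 1) := by
  have hq0 : 0 < q := by linarith
  obtain ⟨C, hC⟩ := h.exists_mul_log_le hb hβ hp hq0 hr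
  by_contra! hcon
  set k : ℝ := (1 / 2) ^ ((b + 1) / r - (β + 1)) with hk
  have hk0 : 0 < k := by positivity
  have key : ∀ X : ℝ, 0 ≤ X → k * X ≤ |C| * (X + Real.log 4) ^ (1 / q) := by
    intro X hX
    have hE : Real.exp (-X) ≤ 1 := Real.exp_le_one_iff.2 (by linarith)
    have hE0 := Real.exp_pos (-X)
    have h1 := hC (1 / 2) (Real.exp (-X) / 2) (by positivity) (by linarith)
    have e1 : Real.log (1 / 2 / (Real.exp (-X) / 2)) = X := by
      rw [show (1 / 2 / (Real.exp (-X) / 2) : ℝ) = (Real.exp (-X))⁻¹ by field_simp, Real.log_inv,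
        Real.log_exp, neg_neg]
    rw [e1, ← hk] at h1
    have hl : 0 < Real.exp (-X) / 2 / 2 := by positivity
    have h2 : ∫ v in Set.Icc (Real.exp (-X) / 2 / 2) (2 * (1 / 2)), v ^ (-(β + 1) * q + a) ≤
        X + Real.log 4 := by
      calc _ ≤ ∫ v in Set.Icc (Real.exp (-X) / 2 / 2) (2 * (1 / 2)), v ^ (-1 : ℝ) := by
            refine setIntegral_mono_on (integrableOn_Icc_rpow _ hl) (integrableOn_Icc_rpow _ hl)
              measurableSet_Icc fun v hv => ?_
            exact Real.rpow_le_rpow_of_exponent_ge (hl.trans_le hv.1) (by linarith [hv.2])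
              (by linarith)
        _ = X + Real.log 4 := by
            simp only [Real.rpow_neg_one]
            rw [integral_Icc_eq_integral_Ioc, ← intervalIntegral.integral_of_le (by linarith),
              integral_inv_of_pos hl (by norm_num),
              show (2 * (1 / 2) / (Real.exp (-X) / 2 / 2) : ℝ) = Real.exp X * 4 by
                rw [Real.exp_neg]; field_simp; norm_num,
              Real.log_mul (Real.exp_pos _).ne' (by norm_num), Real.log_exp]
    have h3 : 0 ≤ ∫ v in Set.Icc (Real.exp (-X) / 2 / 2) (2 * (1 / 2)),
        v ^ (-(β + 1) * q + a) :=
      setIntegral_nonneg measurableSet_Icc fun v hv => Real.rpow_nonneg (hl.le.trans hv.1) _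
    refine h1.trans ?_
    gcongr
    exact le_abs_self C
  have h4 : 0 < Real.log 4 := Real.log_pos (by norm_num)
  have hs : 0 < 1 - 1 / q := by
    rw [sub_pos, div_lt_one hq0]; exact hq
  set B := |C| * 2 ^ (1 / q) / k with hB
  obtain ⟨X, hX1, hX2⟩ := ((tendsto_rpow_atTop hs).eventually_gt_atTop B).and
    (Filter.eventually_ge_atTop (Real.log 4)) |>.exists
  have hX0 : 0 < X := h4.trans_le hX2
  have h5 : k * X ≤ |C| * (2 ^ (1 / q) * X ^ (1 / q)) := by
    rw [← Real.mul_rpow zero_le_two hX0.le]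
    refine (key X hX0.le).trans ?_
    gcongr
    linarith
  have h6 : X = X ^ (1 - 1 / q) * X ^ (1 / q) := by
    rw [← Real.rpow_add hX0, sub_add_cancel, Real.rpow_one]
  rw [hB, div_lt_iff₀ hk0] at hX1
  have h7 : 0 < X ^ (1 / q) := by positivity
  have h8 := mul_lt_mul_of_pos_right hX1 h7
  have h9 : X ^ (1 - 1 / q) * k * X ^ (1 / q) = k * X := by
    nth_rewrite 3 [h6]
    ring
  linarith

end MixedBergman

theorem corollary6p5 (a b β p q r : ℝ) (ha : -1 < a) (hb : -1 < b) (hβ : -1 < β)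
    (hp : 1 < p) (hq : 1 < q) (hqr : q ≤ r) :
    (MixedBergman.BoundedOnSpace β p q r a b ↔
      a + 1 < q * (β + 1) ∧ (a + 1) / q = (b + 1) / r) ∧
    (MixedBergman.BoundedOnTest β p q r a b ↔
      a + 1 < q * (β + 1) ∧ (a + 1) / q = (b + 1) / r) := by
  have hp0 : 0 < p := by linarith
  have hq0 : 0 < q := by linarith
  have hr0 : 0 < r := by linarith
  have sufficient (h : a + 1 < q * (β + 1) ∧ (a + 1) / q = (b + 1) / r) :
      MixedBergman.BoundedOnSpace β p q r a b :=
    MixedBergman.boundedOnSpace_of_lt ha hβ hp hq hqr h.1 h.2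
  have restrict (h : MixedBergman.BoundedOnSpace β p q r a b) :
      MixedBergman.BoundedOnTest β p q r a b := h.boundedOnTest hp0 hq0
  have necessary (h : MixedBergman.BoundedOnTest β p q r a b) :
      a + 1 < q * (β + 1) ∧ (a + 1) / q = (b + 1) / r :=
    ⟨h.lt_mul hb hβ hp0 hq hr0, h.homogeneity hb hβ hp0 hq0 hr0⟩
  exact ⟨⟨fun h => necessary (restrict h), sufficient⟩,
    ⟨necessary, fun h => restrict (sufficient h)⟩⟩
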